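/- Let $P$ be a nonempty finite set of propositional variables. A data word is an infinite sequence $w=(P_0,d_0)(P_1,d_1)\dots$ of pairs in $2^{P}\times\mathbb N$ (the data values need not be monotonic). An interval is an open, half-open or closed, possibly unbounded interval of $\mathbb Z$, given by its endpoints. MTL formulas are $\varphi::=p\mid\neg\varphi\mid\varphi\wedge\varphi\mid\varphi\,\mathsf U_I\,\varphi$ with $p\in P$ and $I$ an interval. Here $(w,i)\models p$ iff $p\in P_i$, the connectives are read as usual, and $(w,i)\models\varphi_1\mathsf U_I\varphi_2$ iff there is $j>i$ with $(w,j)\models\varphi_2$, $d_j-d_i\in I$, and $(w,k)\models\varphi_1$ for all $i<k<j$. The language $L(\varphi)$ is the set of data words $w$ with $(w,0)\models\varphi$. TPTL formulas are $\varphi::=p\mid x\in I\mid\neg\varphi\mid\varphi\wedge\varphi\mid\varphi\,\mathsf U\,\varphi\mid x.\varphi$ with $x$ from a countably infinite set of register variables. They are evaluated at $(w,i,\nu)$, where $\nu$ maps registers to $\mathbb N$: $(w,i,\nu)\models x\in I$ iff $d_i-\nu(x)\in I$; $(w,i,\nu)\models x.\varphi$ iff $(w,i,\nu[x\mapsto d_i])\models\varphi$;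 $(w,i,\nu)\models\varphi_1\mathsf U\varphi_2$ iff there is $j>i$ with $(w,j,\nu)\models\varphi_2$ and $(w,k,\nu)\models\varphi_1$ for all $i<k<j$; the other cases are as for MTL. The language $L(\varphi)$ is the set of data words $w$ with $(w,0,\nu_w)\models\varphi$, where $\nu_w$ maps every register to $d_0$. The until rank of a formula is the maximal nesting depth of until operators in it; $\mathrm{MTL}_k$ and $\mathrm{TPTL}_k$ are the sets of formulas of until rank at most $k$. Write $\mathsf{True}:=p\vee\neg p$, $\mathsf F\varphi:=\mathsf{True}\,\mathsf U\,\varphi$ and $\mathsf X\varphi:=(\neg\mathsf{True})\,\mathsf U\,\varphi$. $\mathrm{TPTL}_{eq}$ is the set of TPTL formulas in which every constraint $x\in I$ has the form $x\in[0,0]$. $\mathrm{TPTL}_{un}$ is the set of TPTL formulas generated by $\varphi::=p\mid\neg\varphi\mid x\in I\mid\varphi\wedge\varphi\mid\mathsf F\varphi\mid\mathsf X\varphi\mid x.\varphi$. A formula $\varphi$ is definable in a set $\mathcal L$ of formulas if $L(\psi)=L(\varphi)$ for some $\psi\in\mathcal L$. **Proposition.** 1. There is $m\in\mathbb N$ such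 that for every $k\ge m$ the problem whether a given formula $\varphi\in\mathrm{MTL}_{k+1}$ is definable in $\mathrm{MTL}_k$ is undecidable. 2. There is $m\in\mathbb N$ such that for every $k\ge m$ the problem whether a given formula $\varphi\in\mathrm{TPTL}_{k+1}$ is definable in $\mathrm{TPTL}_k$ is undecidable. 3. The problem whether a given TPTL formula is definable in $\mathrm{TPTL}_{eq}$ is undecidable. 4. The problem whether a given TPTL formula is definable in $\mathrm{TPTL}_{un}$ is undecidable. -/

import Mathlib

namespace DataLogic

/-- An (omega-)data word over the set `P` of propositional variables: an infinite sequence of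
pairs in `2^P × ℕ`. -/
abbrev DataWord (P : Type*) := ℕ → Set P × ℕ

/-- The data value `d_i` of a data word, as an integer. -/
def DataWord.val {P : Type*} (w : DataWord P) (i : ℕ) : ℤ := ((w i).2 : ℤ)

/-! ### Intervals over the integers (finite syntactic objects) -/

/-- An endpoint of an interval: absent (that is `-∞` on the left, `+∞` on the right),
or an integer that is included (`closed`) or excluded (`strict`). -/
inductive Endpoint where
  | infinite : Endpoint
  | closed : ℤ → Endpoint
  | strict : ℤ → Endpoint

/-- `z` lies to the right of the left endpoint. -/
def Endpoint.Lower (z : ℤ) : Endpoint → Prop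
  | .infinite => True
  | .closed a => a ≤ z
  | .strict a => a < z

/-- `z` lies to the left of the right endpoint. -/
def Endpoint.Upper (z : ℤ) : Endpoint → Prop
  | .infinite => True
  | .closed a => z ≤ a
  | .strict a => z < a

/-- An open, half-open or closed, possibly unbounded interval over the integers. -/
structure IntInterval where
  lo : Endpoint
  hi : Endpoint

/-- The set of integers that an interval denotes. -/
def IntInterval.toSet (I : IntInterval) : Set ℤ := {z | I.lo.Lower z ∧ I.hi.Upper z}

/-- The interval `[0,0]`. -/
def IntInterval.zero : IntInterval := ⟨.closed 0, .closed 0⟩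

/-! ### Syntax -/

/-- Formulas of Metric Temporal Logic. -/
inductive MTL (P : Type*) where
  | prop : P → MTL P
  | neg : MTL P → MTL P
  | and : MTL P → MTL P → MTL P
  | untl : IntInterval → MTL P → MTL P → MTL P

/-- Formulas of Timed Propositional Temporal Logic; the register variables are the natural
numbers. `cmp x I` is `x ∈ I`, `freeze x φ` is `x.φ`. -/
inductive TPTL (P : Type*) where
  | prop : P → TPTL P
  | cmp : ℕ → IntInterval → TPTL P
  | neg : TPTL P → TPTL P
  | and : TPTL P → TPTL P → TPTL P
  | untl : TPTL P → TPTL P → TPTL P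
  | freeze : ℕ → TPTL P → TPTL P

variable {P : Type*}

/-! ### Semantics (strict until) -/

/-- `(w,i) ⊨ φ` for MTL. -/
def MTL.Sat (w : DataWord P) : MTL P → ℕ → Prop
  | .prop p, i => p ∈ (w i).1
  | .neg φ, i => ¬ φ.Sat w i
  | .and φ ψ, i => φ.Sat w i ∧ ψ.Sat w i
  | .untl I φ ψ, i => ∃ j, i < j ∧ ψ.Sat w j ∧ w.val j - w.val i ∈ I.toSet ∧
      ∀ k, i < k → k < j → φ.Sat w k

/-- `(w,i,ν) ⊨ φ` for TPTL. -/
def TPTL.Sat (w : DataWord P) : TPTL P → ℕ → (ℕ → ℕ) → Prop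
  | .prop p, i, _ => p ∈ (w i).1
  | .cmp x I, i, ν => w.val i - (ν x : ℤ) ∈ I.toSet
  | .neg φ, i, ν => ¬ φ.Sat w i ν
  | .and φ ψ, i, ν => φ.Sat w i ν ∧ ψ.Sat w i ν
  | .untl φ ψ, i, ν => ∃ j, i < j ∧ ψ.Sat w j ν ∧ ∀ k, i < k → k < j → φ.Sat w k ν
  | .freeze x φ, i, ν => φ.Sat w i (Function.update ν x (w i).2)

/-- The data language `L(φ)` of an MTL-formula. -/
def MTL.lang (φ : MTL P) : Set (DataWord P) := {w | φ.Sat w 0}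

/-- The data language `L(φ)` of a TPTL-formula; initially every register holds `d_0`. -/
def TPTL.lang (φ : TPTL P) : Set (DataWord P) := {w | φ.Sat w 0 (fun _ => (w 0).2)}

/-! ### Until rank and fragments -/

/-- Until rank of an MTL-formula. -/
def MTL.urk : MTL P → ℕ
  | .prop _ => 0
  | .neg φ => φ.urk
  | .and φ ψ => max φ.urk ψ.urk
  | .untl _ φ ψ => max φ.urk ψ.urk + 1

/-- Until rank of a TPTL-formula. -/
def TPTL.urk : TPTL P → ℕ
  | .prop _ => 0
  | .cmp _ _ => 0
  | .neg φ => φ.urk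
  | .and φ ψ => max φ.urk ψ.urk
  | .untl φ ψ => max φ.urk ψ.urk + 1
  | .freeze _ φ => φ.urk

variable (P) in
/-- `MTL_k`: the MTL-formulas of until rank at most `k`. -/
def MTLRank (k : ℕ) : Set (MTL P) := {φ | φ.urk ≤ k}

variable (P) in
/-- `TPTL_k`: the TPTL-formulas of until rank at most `k`. -/
def TPTLRank (k : ℕ) : Set (TPTL P) := {φ | φ.urk ≤ k}

/-- `φ ∨ ψ`. -/
def TPTL.or (φ ψ : TPTL P) : TPTL P := .neg (.and (.neg φ) (.neg ψ))

/-- `True := p ∨ ¬ p`. -/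
def TPTL.tt (p : P) : TPTL P := .or (.prop p) (.neg (.prop p))

/-- `False := ¬ True`. -/
def TPTL.ff (p : P) : TPTL P := .neg (.tt p)

/-- `F φ := True U φ`. -/
def TPTL.eventually (p : P) (φ : TPTL P) : TPTL P := .untl (.tt p) φ

/-- `X φ := False U φ`. -/
def TPTL.next (p : P) (φ : TPTL P) : TPTL P := .untl (.ff p) φ

/-- The formulas of the unary fragment: the until operator is used only to form `F` and `X`
(with any propositional variable in the abbreviation `True`). -/
inductive TPTL.IsUnary : TPTL P → Prop
  | prop (p : P) : IsUnary (.prop p)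
  | neg {φ : TPTL P} : IsUnary φ → IsUnary (.neg φ)
  | cmp (x : ℕ) (I : IntInterval) : IsUnary (.cmp x I)
  | and {φ ψ : TPTL P} : IsUnary φ → IsUnary ψ → IsUnary (.and φ ψ)
  | eventually (p : P) {φ : TPTL P} : IsUnary φ → IsUnary (.eventually p φ)
  | next (p : P) {φ : TPTL P} : IsUnary φ → IsUnary (.next p φ)
  | freeze (x : ℕ) {φ : TPTL P} : IsUnary φ → IsUnary (.freeze x φ)

/-- Every register constraint in the formula has the form `x ∈ [0,0]`. -/
def TPTL.OnlyEq : TPTL P → Prop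
  | .prop _ => True
  | .cmp _ I => I = IntInterval.zero
  | .neg φ => φ.OnlyEq
  | .and φ ψ => φ.OnlyEq ∧ ψ.OnlyEq
  | .untl φ ψ => φ.OnlyEq ∧ ψ.OnlyEq
  | .freeze _ φ => φ.OnlyEq

variable (P) in
/-- The unary fragment `TPTL_un`. -/
def TPTLun : Set (TPTL P) := {φ | φ.IsUnary}

variable (P) in
/-- The equality fragment `TPTL_eq`. -/
def TPTLeq : Set (TPTL P) := {φ | φ.OnlyEq}

/-- `φ` is definable in the set `S` of MTL-formulas. -/
def MTL.DefinableIn (φ : MTL P) (S : Set (MTL P)) : Prop := ∃ ψ ∈ S, ψ.lang = φ.lang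

/-- `φ` is definable in the set `S` of TPTL-formulas. -/
def TPTL.DefinableIn (φ : TPTL P) (S : Set (TPTL P)) : Prop := ∃ ψ ∈ S, ψ.lang = φ.lang

/-! ### Gödel numbers and decidability -/

/-- Gödel number of an integer: the pair of its positive and negative parts. -/
def intCode (a : ℤ) : ℕ := Nat.pair a.toNat (-a).toNat

def Endpoint.code : Endpoint → ℕ
  | .infinite => Nat.pair 0 0
  | .closed a => Nat.pair 1 (intCode a)
  | .strict a => Nat.pair 2 (intCode a)

def IntInterval.code (I : IntInterval) : ℕ := Nat.pair I.lo.code I.hi.code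

/-- Gödel number of an MTL-formula. -/
def MTL.code [Encodable P] : MTL P → ℕ
  | .prop p => Nat.pair 0 (Encodable.encode p)
  | .neg φ => Nat.pair 1 φ.code
  | .and φ ψ => Nat.pair 2 (Nat.pair φ.code ψ.code)
  | .untl I φ ψ => Nat.pair 3 (Nat.pair I.code (Nat.pair φ.code ψ.code))

/-- Gödel number of a TPTL-formula. -/
def TPTL.code [Encodable P] : TPTL P → ℕ
  | .prop p => Nat.pair 0 (Encodable.encode p)
  | .cmp x I => Nat.pair 1 (Nat.pair x I.code)
  | .neg φ => Nat.pair 2 φ.code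
  | .and φ ψ => Nat.pair 3 (Nat.pair φ.code ψ.code)
  | .untl φ ψ => Nat.pair 4 (Nat.pair φ.code ψ.code)
  | .freeze x φ => Nat.pair 5 (Nat.pair x φ.code)

theorem intCode_injective : Function.Injective intCode := by
  intro a b h
  simp only [intCode, Nat.pair_eq_pair] at h
  omega

theorem Endpoint.code_injective : Function.Injective Endpoint.code := by
  intro a b h
  cases a <;> cases b <;> simp_all [Endpoint.code, Nat.pair_eq_pair, intCode_injective.eq_iff]

theorem IntInterval.code_injective : Function.Injective IntInterval.code := by
  rintro ⟨a, b⟩ ⟨c, d⟩ h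
  simp only [IntInterval.code, Nat.pair_eq_pair] at h
  rw [Endpoint.code_injective h.1, Endpoint.code_injective h.2]

theorem MTL.code_injective [Encodable P] :
    Function.Injective (MTL.code : MTL P → ℕ) := by
  intro a
  induction a with
  | prop p => intro b h; cases b <;> simp_all [MTL.code, Nat.pair_eq_pair]
  | neg φ ih =>
    intro b h
    cases b <;> simp [MTL.code, Nat.pair_eq_pair] at h ⊢
    exact ih h
  | and φ ψ ih1 ih2 =>
    intro b h
    cases b <;> simp [MTL.code, Nat.pair_eq_pair] at h ⊢
    exact ⟨ih1 h.1, ih2 h.2⟩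
  | untl I φ ψ ih1 ih2 =>
    intro b h
    cases b <;> simp [MTL.code, Nat.pair_eq_pair] at h ⊢
    exact ⟨IntInterval.code_injective h.1, ih1 h.2.1, ih2 h.2.2⟩

theorem TPTL.code_injective [Encodable P] :
    Function.Injective (TPTL.code : TPTL P → ℕ) := by
  intro a
  induction a with
  | prop p => intro b h; cases b <;> simp_all [TPTL.code, Nat.pair_eq_pair]
  | cmp x I =>
    intro b h
    cases b <;> simp [TPTL.code, Nat.pair_eq_pair] at h ⊢
    exact ⟨h.1, IntInterval.code_injective h.2⟩
  | neg φ ih =>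
    intro b h
    cases b <;> simp [TPTL.code, Nat.pair_eq_pair] at h ⊢
    exact ih h
  | and φ ψ ih1 ih2 =>
    intro b h
    cases b <;> simp [TPTL.code, Nat.pair_eq_pair] at h ⊢
    exact ⟨ih1 h.1, ih2 h.2⟩
  | untl φ ψ ih1 ih2 =>
    intro b h
    cases b <;> simp [TPTL.code, Nat.pair_eq_pair] at h ⊢
    exact ⟨ih1 h.1, ih2 h.2⟩
  | freeze x φ ih =>
    intro b h
    cases b <;> simp [TPTL.code, Nat.pair_eq_pair] at h ⊢
    exact ⟨h.1, ih h.2⟩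

/-- The decision problem "given an object of `inst` (through its code), does it have the property
`Q`?" is decidable: some computable set of natural numbers contains the code of an instance if
and only if the instance has the property. -/
def DecidableProblem {α : Type*} (code : α → ℕ) (inst : Set α) (Q : α → Prop) : Prop :=
  ∃ A : ℕ → Prop, ComputablePred A ∧ ∀ a ∈ inst, (A (code a) ↔ Q a)

end DataLogic

/-! Halting is reduced to definability. For a fixed partial recursive `f` with undecidable domain
there are MTL formulas `haltF N e p n` that are satisfiable iff `f n` is defined
(`exists_sat_haltF_iff`, `exists_net_dom`). They come from a finite automaton whose events write or
read registers and constrain the gap between consecutively produced values: gaps give increments and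
comparisons, which suffices for all partial recursive functions. A number is stored as its offset
from register 0, because the logics only see differences of data values. A run is written as a data
word with a single proposition `p`: `p` marks an event, the difference to the next data value names
the node.

Let `χ` be such a formula, and let `φ` be a formula that the smaller fragment cannot express, even
on words ending in a prescribed suffix (`Confuses`). If `χ` is unsatisfiable, `φ ∧ F χ` has the
empty language and is definable. If `t` satisfies `χ`, then for every `ψ` of the fragment some word
ending in `t` satisfies `φ`, another word violates `φ`, and `ψ` accepts the second if it accepts the
first; so `ψ` does not define `φ ∧ F χ` (`definableIn_toTPTL_iff`).

The formulas `φ` are: `X^(k+1) ¬p` against rank `k`, since rank `k` cannot count more than `k`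
repeated letters (`TPTL.sat_rep`); "the next value is smaller" against equality constraints, which
survive injective renaming of values (`TPTL.sat_rename`); and `(¬p) U (p ∧ X p)` against `F` and
`X`, which on a periodic word see only a bounded window (`TPTL.IsUnary.sat_periodic`). The MTL case
follows from the TPTL case, since MTL embeds in TPTL with the same rank. The input `n` occurs only
in an interval `[n,n]`, so the until rank of `χ` does not depend on `n`; this rank serves as the
bound `m`. -/

namespace DataLogic

/-! ### Nondeterministic register automata -/

/-- An event of a register automaton: it produces a data value whose difference from the previously
produced value lies in `gap`, and either writes it to the register `reg` or checks that it is the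
content of `reg`. -/
structure RegEvent where
  reg : ℕ
  write : Bool
  gap : IntInterval

/-- The contents of the registers and the last produced data value. -/
abbrev RegState := (ℕ → ℕ) × ℕ

def RegEvent.Exec (e : RegEvent) (s s' : RegState) : Prop :=
  (s'.2 : ℤ) - s.2 ∈ e.gap.toSet ∧
    ((e.write = true ∧ s'.1 = Function.update s.1 e.reg s'.2) ∨
      (e.write = false ∧ s'.1 = s.1 ∧ s'.2 = s.1 e.reg))

/-- A finite automaton whose nodes are labelled by register events. -/
structure Net where
  Node : Type
  finite : Finite Node
  event : Node → RegEvent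
  first : Node → Prop
  last : Node → Prop
  follow : Node → Node → Prop

/-- `N.Go t s s'`: some path of `N` from the node `t` to a last node transforms `s` into `s'`. -/
inductive Net.Go (N : Net) : N.Node → RegState → RegState → Prop
  | last {t s s'} : (N.event t).Exec s s' → N.last t → Net.Go N t s s'
  | step {t t' s s₁ s'} : (N.event t).Exec s s₁ → N.follow t t' → Net.Go N t' s₁ s' →
      Net.Go N t s s'

def Net.Run (N : Net) (s s' : RegState) : Prop := ∃ t, N.first t ∧ N.Go t s s'

def Net.single (e : RegEvent) : Net where
  Node := Unit
  finite := inferInstance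
  event _ := e
  first _ := True
  last _ := True
  follow _ _ := False

theorem Net.run_single {e : RegEvent} {s s' : RegState} :
    (Net.single e).Run s s' ↔ e.Exec s s' := by
  constructor
  · rintro ⟨t, -, h⟩
    cases h with
    | last h _ => exact h
    | step _ h _ => exact h.elim
  · exact fun h => ⟨(), trivial, .last h trivial⟩

/-- Runs of `A` followed by runs of `B`. -/
def Net.seq (A B : Net) : Net where
  Node := A.Node ⊕ B.Node
  finite := have := A.finite; have := B.finite; inferInstance
  event := Sum.elim A.event B.event
  first := Sum.elim A.first fun _ => False
  last := Sum.elim (fun _ => False) B.last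
  follow
    | .inl t, .inl t' => A.follow t t'
    | .inl t, .inr t' => A.last t ∧ B.first t'
    | .inr _, .inl _ => False
    | .inr t, .inr t' => B.follow t t'

/-- Finitely many (possibly no) runs of `A` followed by a run of `B`. -/
def Net.loop (A B : Net) : Net where
  Node := A.Node ⊕ B.Node
  finite := have := A.finite; have := B.finite; inferInstance
  event := Sum.elim A.event B.event
  first := Sum.elim A.first B.first
  last := Sum.elim (fun _ => False) B.last
  follow
    | .inl t, .inl t' => A.follow t t' ∨ (A.last t ∧ A.first t')
    | .inl t, .inr t' => A.last t ∧ B.first t'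
    | .inr _, .inl _ => False
    | .inr t, .inr t' => B.follow t t'

theorem Net.go_seq_inr {A B : Net} {t : B.Node} {s s' : RegState} :
    (A.seq B).Go (.inr t) s s' ↔ B.Go t s s' := by
  constructor
  · suffices ∀ u s, (A.seq B).Go u s s' → ∀ t, u = .inr t → B.Go t s s' from
      fun h => this _ _ h t rfl
    intro u s h
    induction h with
    | last h hl => rintro t rfl; exact .last h hl
    | @step _ t' _ _ _ h hf _ ih =>
      rintro t rfl
      rcases t' with t' | t'
      · exact hf.elim
      · exact .step h hf (ih _ rfl)
  · intro h
    induction h with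
    | last h hl => exact .last h hl
    | @step t t' _ _ _ h hf _ ih => exact .step (N := A.seq B) (t' := .inr t') h hf ih

theorem Net.go_loop_inr {A B : Net} {t : B.Node} {s s' : RegState} :
    (A.loop B).Go (.inr t) s s' ↔ B.Go t s s' := by
  constructor
  · suffices ∀ u s, (A.loop B).Go u s s' → ∀ t, u = .inr t → B.Go t s s' from
      fun h => this _ _ h t rfl
    intro u s h
    induction h with
    | last h hl => rintro t rfl; exact .last h hl
    | @step _ t' _ _ _ h hf _ ih =>
      rintro t rfl
      rcases t' with t' | t'
      · exact hf.elim
      · exact .step h hf (ih _ rfl)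
  · intro h
    induction h with
    | last h hl => exact .last h hl
    | @step t t' _ _ _ h hf _ ih => exact .step (N := A.loop B) (t' := .inr t') h hf ih

theorem Net.run_seq {A B : Net} {s s' : RegState} :
    (A.seq B).Run s s' ↔ ∃ m, A.Run s m ∧ B.Run m s' := by
  constructor
  · rintro ⟨t, ht, h⟩
    rcases t with t | t
    · suffices ∀ u s, (A.seq B).Go u s s' → ∀ t, u = .inl t → ∃ m, A.Go t s m ∧ B.Run m s' by
        obtain ⟨m, h1, h2⟩ := this _ _ h t rfl
        exact ⟨m, ⟨t, ht, h1⟩, h2⟩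
      clear h ht t
      intro u s h
      induction h with
      | last _ hl => rintro t rfl; exact hl.elim
      | @step _ t' _ s₁ _ h hf hg ih =>
        rintro t rfl
        rcases t' with t' | t'
        · obtain ⟨m, h1, h2⟩ := ih _ rfl
          exact ⟨m, .step h hf h1, h2⟩
        · exact ⟨s₁, .last h hf.1, t', hf.2, go_seq_inr.1 hg⟩
    · exact ht.elim
  · rintro ⟨m, ⟨t, ht, h⟩, ⟨t', ht', h'⟩⟩
    refine ⟨.inl t, ht, ?_⟩
    clear ht
    induction h with
    | last h hl => exact .step (N := A.seq B) (t' := .inr t') h ⟨hl, ht'⟩ (go_seq_inr.2 h')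
    | @step t u _ _ _ h hf _ ih => exact .step (N := A.seq B) (t' := .inl u) h hf (ih h')

theorem Net.run_loop {A B : Net} {s s' : RegState} :
    (A.loop B).Run s s' ↔ ∃ m, Relation.ReflTransGen A.Run s m ∧ B.Run m s' := by
  constructor
  · rintro ⟨t, ht, h⟩
    rcases t with t | t
    -- A path that starts inside `A` first finishes the current pass, hence the separate states `m`
    -- after this pass and `n` after all passes.
    · suffices ∀ u s, (A.loop B).Go u s s' → ∀ t, u = .inl t →
          ∃ m n, A.Go t s m ∧ Relation.ReflTransGen A.Run m n ∧ B.Run n s' by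
        obtain ⟨m, n, h1, h2, h3⟩ := this _ _ h t rfl
        exact ⟨n, .head ⟨t, ht, h1⟩ h2, h3⟩
      clear h ht t
      intro u s h
      induction h with
      | last _ hl => rintro t rfl; exact hl.elim
      | @step _ t' _ s₁ _ h hf hg ih =>
        rintro t rfl
        rcases t' with t' | t'
        · obtain ⟨m, n, h1, h2, h3⟩ := ih _ rfl
          rcases hf with hf | hf
          · exact ⟨m, n, .step h hf h1, h2, h3⟩
          · exact ⟨s₁, n, .last h hf.1, .head ⟨t', hf.2, h1⟩ h2, h3⟩
        · exact ⟨s₁, s₁, .last h hf.1, .refl, t', hf.2, go_loop_inr.1 hg⟩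
    · exact ⟨s, .refl, t, ht, go_loop_inr.1 h⟩
  · rintro ⟨m, h, t, ht, hB⟩
    induction h using Relation.ReflTransGen.head_induction_on with
    | refl => exact ⟨.inr t, ht, go_loop_inr.2 hB⟩
    | head h _ ih =>
      obtain ⟨u, hu, hgo⟩ := ih
      obtain ⟨t, ht, h⟩ := h
      refine ⟨.inl t, ht, ?_⟩
      clear ht
      rename_i hm
      clear hm
      induction h with
      | last h hl =>
        rcases u with u | u
        · exact .step (N := A.loop B) (t' := .inl u) h (.inr ⟨hl, hu⟩) hgo
        · exact .step (N := A.loop B) (t' := .inr u) h ⟨hl, hu⟩ hgo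
      | @step t u _ _ _ h hf _ ih =>
        exact .step (N := A.loop B) (t' := .inl u) h (.inl hf) (ih hgo)

/-! ### Intervals -/

/-- The interval `[c,c]`. -/
def IntInterval.point (c : ℤ) : IntInterval := ⟨.closed c, .closed c⟩

/-- The interval of all integers. -/
def IntInterval.all : IntInterval := ⟨.infinite, .infinite⟩

def IntInterval.neg : IntInterval := ⟨.infinite, .strict 0⟩

def IntInterval.pos : IntInterval := ⟨.strict 0, .infinite⟩

@[simp] theorem IntInterval.mem_point {c z : ℤ} : z ∈ (IntInterval.point c).toSet ↔ z = c := by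
  simp only [toSet, point, Endpoint.Lower, Endpoint.Upper, Set.mem_ofPred_eq]; omega

@[simp] theorem IntInterval.mem_all {z : ℤ} : z ∈ IntInterval.all.toSet :=
  ⟨trivial, trivial⟩

@[simp] theorem IntInterval.mem_neg {z : ℤ} : z ∈ IntInterval.neg.toSet ↔ z < 0 := by
  simp [toSet, neg, Endpoint.Lower, Endpoint.Upper]

@[simp] theorem IntInterval.mem_pos {z : ℤ} : z ∈ IntInterval.pos.toSet ↔ 0 < z := by
  simp [toSet, pos, Endpoint.Lower, Endpoint.Upper]

/-! ### Register programs for partial recursive functions -/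

/-- The assignment `r := s + c`. -/
def Net.move (s r c : ℕ) : Net :=
  .seq (.single ⟨s, false, .all⟩) (.single ⟨r, true, .point c⟩)

/-- The test that the difference of the registers `r` and `s` lies in `J`. -/
def Net.test (s r : ℕ) (J : IntInterval) : Net :=
  .seq (.single ⟨s, false, .all⟩) (.single ⟨r, false, J⟩)

/-- Reading `s` makes its content the last produced value, so the gap of the next event is measured
from it. In this way a constraint on consecutive values acts on registers. -/
theorem Net.run_move {s r c : ℕ} {σ σ' : RegState} :
    (Net.move s r c).Run σ σ' ↔ σ' = (Function.update σ.1 r (σ.1 s + c), σ.1 s + c) := by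
  obtain ⟨ν, a⟩ := σ
  obtain ⟨ν', a'⟩ := σ'
  simp only [move, run_seq, run_single, RegEvent.Exec, IntInterval.mem_all, IntInterval.mem_point]
  constructor
  · rintro ⟨⟨ν₁, a₁⟩, ⟨-, h⟩, h1, h2⟩
    simp only [Bool.false_eq_true, false_and, true_and, false_or, reduceCtorEq] at h h1 h2
    obtain ⟨rfl, rfl⟩ := h
    have : a' = ν₁ s + c := by omega
    subst this
    rw [h2.resolve_right id]
  · rintro h
    simp only [Prod.mk.injEq] at h
    obtain ⟨rfl, rfl⟩ := h
    refine ⟨(ν, ν s), ?_, ?_⟩ <;> simp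

theorem Net.run_test {s r : ℕ} {J : IntInterval} {σ σ' : RegState} :
    (Net.test s r J).Run σ σ' ↔ σ' = (σ.1, σ.1 r) ∧ (σ.1 r : ℤ) - σ.1 s ∈ J.toSet := by
  obtain ⟨ν, a⟩ := σ
  obtain ⟨ν', a'⟩ := σ'
  simp only [test, run_seq, run_single, RegEvent.Exec, IntInterval.mem_all]
  constructor
  · rintro ⟨⟨ν₁, a₁⟩, ⟨-, h⟩, h1, h2⟩
    simp only [Bool.false_eq_true, false_and, true_and, false_or] at h h1 h2
    obtain ⟨rfl, rfl⟩ := h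
    obtain ⟨rfl, rfl⟩ := h2
    exact ⟨rfl, h1⟩
  · rintro ⟨h, hJ⟩
    simp only [Prod.mk.injEq] at h
    obtain ⟨rfl, rfl⟩ := h
    refine ⟨(ν', ν' s), ?_, ?_⟩ <;> simp [hJ]

/-- `s'` arises from `s` by storing `y` (relative to register `0`) in register `o`, where
the registers from `b` on may change arbitrarily. -/
def Stored (s s' : RegState) (o b y : ℕ) : Prop :=
  s'.1 o = s.1 0 + y ∧ ∀ r < b, r ≠ o → s'.1 r = s.1 r

/-- The runs of `N` store the value of `f` at the content of the registers `xs` in register `o`,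
and use the registers from `b` on as scratch space. Register contents are relative to
register `0`. -/
def Net.Computes {n : ℕ} (N : Net) (f : List.Vector ℕ n →. ℕ) (xs : Fin n → ℕ) (o b : ℕ) : Prop :=
  ∀ (v : List.Vector ℕ n) (s : RegState), (∀ i, s.1 (xs i) = s.1 0 + v.get i) →
    (∀ s', N.Run s s' → ∃ y ∈ f v, Stored s s' o b y) ∧
    ∀ y ∈ f v, ∃ s', N.Run s s' ∧ Stored s s' o b y

/-- `f` is computed by register programs, for all choices of the registers. -/
def Programmable {n : ℕ} (f : List.Vector ℕ n →. ℕ) : Prop :=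
  ∀ (xs : Fin n → ℕ) (o b : ℕ), (∀ i, xs i < b) → 0 < o → o < b → ∃ N : Net, N.Computes f xs o b

theorem Programmable.zero : Programmable (n := 0) fun _ => Part.some 0 := by
  intro xs o b _ _ _
  refine ⟨.move 0 o 0, fun v s hs => ?_⟩
  simp +contextual [Net.run_move, Stored]

theorem Programmable.succ :
    Programmable (n := 1) fun v => Part.some (Nat.succ v.head) := by
  intro xs o b _ _ _
  refine ⟨.move (xs 0) o 1, fun v s hs => ?_⟩
  have := hs 0
  simp +contextual [Net.run_move, Stored, this, add_assoc]

theorem Programmable.get {n : ℕ} (i : Fin n) :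
    Programmable (n := n) fun v => Part.some (v.get i) := by
  intro xs o b _ _ _
  refine ⟨.move (xs i) o 0, fun v s hs => ?_⟩
  simp +contextual [Net.run_move, Stored, hs]

/-- Component `i` is stored in register `c + i`, with everything above as scratch space. The inputs
and the earlier results lie below the scratch bound, so later programs leave them intact. -/
theorem exists_net_vector {m n : ℕ} (g : Fin n → List.Vector ℕ m →. ℕ)
    (hg : ∀ i, Programmable (g i)) (xs : Fin m → ℕ) (c : ℕ) (hxs : ∀ i, xs i < c) (hc : 0 < c) :
    ∃ N : Net, ∀ (v : List.Vector ℕ m) (s : RegState), (∀ i, s.1 (xs i) = s.1 0 + v.get i) →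
      (∀ s', N.Run s s' → ∃ w : Fin n → ℕ, (∀ i, w i ∈ g i v) ∧
        (∀ i : Fin n, s'.1 (c + i) = s.1 0 + w i) ∧ ∀ r < c, s'.1 r = s.1 r) ∧
      ∀ w : Fin n → ℕ, (∀ i, w i ∈ g i v) → ∃ s', N.Run s s' ∧
        (∀ i : Fin n, s'.1 (c + i) = s.1 0 + w i) ∧ ∀ r < c, s'.1 r = s.1 r := by
  induction n with
  | zero =>
    -- Every run contains at least one event, so a vacuous test serves as the empty program.
    refine ⟨.test 0 0 .all, fun v s hs => ?_⟩
    simp [Net.run_test]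
  | succ n ih =>
    obtain ⟨A, hA⟩ := ih (fun i => g i.castSucc) fun i => hg i.castSucc
    obtain ⟨B, hB⟩ := hg (Fin.last n) xs (c + n) (c + n + 1)
      (fun i => (hxs i).trans (by omega)) (by omega) (by omega)
    refine ⟨A.seq B, fun v s hs => ?_⟩
    obtain ⟨hA1, hA2⟩ := hA v s hs
    have key : ∀ m : RegState, (∀ r < c, m.1 r = s.1 r) → ∀ i, m.1 (xs i) = m.1 0 + v.get i :=
      fun m hm i => by rw [hm _ (hxs i), hm 0 hc, hs]
    constructor
    · intro s' h
      obtain ⟨m, h1, h2⟩ := Net.run_seq.1 h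
      obtain ⟨w, hw, hw1, hw2⟩ := hA1 m h1
      obtain ⟨y, hy, hy1, hy2⟩ := (hB v m (key m hw2)).1 s' h2
      refine ⟨Fin.snoc (α := fun _ => ℕ) w y, fun i => ?_, fun i => ?_, fun r hr => ?_⟩
      · refine Fin.lastCases ?_ (fun i => ?_) i <;> simp [hy, hw]
      · refine Fin.lastCases ?_ (fun i => ?_) i
        · simp [hy1, hw2 0 hc]
        · rw [Fin.val_castSucc, hy2 _ (by omega) (by omega), hw1]; simp
      · rw [hy2 _ (by omega) (by omega), hw2 _ hr]
    · intro w hw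
      obtain ⟨m, h1, hw1, hw2⟩ := hA2 (fun i => w i.castSucc) fun i => hw _
      obtain ⟨s', h2, hy1, hy2⟩ := (hB v m (key m hw2)).2 (w (Fin.last n)) (hw _)
      refine ⟨s', Net.run_seq.2 ⟨m, h1, h2⟩, fun i => ?_, fun r hr => ?_⟩
      · refine Fin.lastCases ?_ (fun i => ?_) i
        · simp [hy1, hw2 0 hc]
        · rw [Fin.val_castSucc, hy2 _ (by omega) (by omega), hw1]
      · rw [hy2 _ (by omega) (by omega), hw2 _ hr]

theorem mem_mOfFn {n : ℕ} (g : Fin n → Part ℕ) (w : List.Vector ℕ n) :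
    w ∈ List.Vector.mOfFn g ↔ ∀ i, w.get i ∈ g i := by
  induction n with
  | zero =>
    simp only [List.Vector.mOfFn, IsEmpty.forall_iff, iff_true]
    rw [Subsingleton.elim w List.Vector.nil]
    exact Part.mem_some _
  | succ n ih =>
    rw [Fin.forall_fin_succ]
    simp only [List.Vector.mOfFn, Part.bind_eq_bind, Part.mem_bind_iff, ih]
    constructor
    · rintro ⟨a, ha, u, hu, hw⟩
      obtain rfl := Part.mem_some_iff.1 hw
      simpa using ⟨ha, hu⟩
    · rintro ⟨h0, h1⟩
      refine ⟨_, h0, w.tail, fun i => by simpa using h1 i, ?_⟩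
      refine Part.mem_some_iff.2 ?_
      simp

theorem Programmable.comp {m n : ℕ} {f : List.Vector ℕ n →. ℕ} (g : Fin n → List.Vector ℕ m →. ℕ)
    (hf : Programmable f) (hg : ∀ i, Programmable (g i)) :
    Programmable fun v => (List.Vector.mOfFn fun i => g i v) >>= f := by
  intro xs o b hxs ho hob
  obtain ⟨A, hA⟩ := exists_net_vector g hg xs b hxs (ho.trans hob)
  obtain ⟨B, hB⟩ := hf (fun i => b + i) o (b + n) (by simp) ho (by omega)
  refine ⟨A.seq B, fun v s hs => ?_⟩
  obtain ⟨hA1, hA2⟩ := hA v s hs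
  have hz : 0 < b := ho.trans hob
  constructor
  · intro s' h
    obtain ⟨m, h1, h2⟩ := Net.run_seq.1 h
    obtain ⟨w, hw, hw1, hw2⟩ := hA1 m h1
    obtain ⟨y, hy, hy1, hy2⟩ := (hB (List.Vector.ofFn w) m (by simp [hw1, hw2 0 hz])).1 s' h2
    refine ⟨y, ?_, by rw [hy1, hw2 0 hz], fun r hr hro => ?_⟩
    · exact Part.mem_bind_iff.2 ⟨_, (mem_mOfFn _ _).2 (by simpa using hw), hy⟩
    · rw [hy2 r (by omega) hro, hw2 r hr]
  · intro y hy
    obtain ⟨w, hw, hy⟩ := Part.mem_bind_iff.1 hy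
    obtain ⟨m, h1, hw1, hw2⟩ := hA2 w.get ((mem_mOfFn _ _).1 hw)
    obtain ⟨s', h2, hy1, hy2⟩ := (hB w m (by simp [hw1, hw2 0 hz])).2 y hy
    refine ⟨s', Net.run_seq.2 ⟨m, h1, h2⟩, by rw [hy1, hw2 0 hz], fun r hr hro => ?_⟩
    rw [hy2 r (by omega) hro, hw2 r hr]

theorem Net.Computes.run {n : ℕ} {N : Net} {f : List.Vector ℕ n → ℕ} {xs : Fin n → ℕ} {o b : ℕ}
    (h : N.Computes (fun v => Part.some (f v)) xs o b) {v : List.Vector ℕ n} {s : RegState}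
    (hs : ∀ i, s.1 (xs i) = s.1 0 + v.get i) :
    (∀ s', N.Run s s' → Stored s s' o b (f v)) ∧ ∃ s', N.Run s s' := by
  obtain ⟨h1, h2⟩ := h v s hs
  simp only [Part.mem_some_iff, exists_eq_left, forall_eq] at h1 h2
  exact ⟨h1, h2.imp fun _ => And.left⟩

/-- Register `b` counts the iterations and `b + 1` holds the current value of the recursion. The
loop guesses its length; the exit test, counter equal to recursion argument, rules out wrong
guesses. The register `o` may be one of the inputs, so it is written only at the end. -/
theorem Programmable.prec {n : ℕ} {f : List.Vector ℕ n → ℕ} {g : List.Vector ℕ (n + 2) → ℕ}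
    (hf : Programmable fun v => Part.some (f v)) (hg : Programmable fun v => Part.some (g v)) :
    Programmable fun v : List.Vector ℕ (n + 1) =>
      Part.some (v.head.rec (f v.tail) fun y IH => g (y ::ᵥ IH ::ᵥ v.tail)) := by
  intro xs o b hxs ho hob
  obtain ⟨A, hA⟩ := hf (fun i => xs i.succ) (b + 1) (b + 2)
    (fun i => (hxs _).trans (by omega)) (by omega) (by omega)
  -- The previous value is read from `b + 1` and overwritten there: an output register may also be
  -- an input.
  obtain ⟨B, hB⟩ := hg (Fin.cons b (Fin.cons (b + 1) fun i => xs i.succ)) (b + 1) (b + 2)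
    (by
      intro i
      refine Fin.cases (by simp) (fun i => Fin.cases (by simp) (fun i => ?_) i) i
      simpa using (hxs _).trans (by omega))
    (by omega) (by omega)
  let M : Net := (Net.move 0 b 0).seq (A.seq ((B.seq (.move b b 1)).loop
    ((Net.test (xs 0) b (.point 0)).seq (.move (b + 1) o 0))))
  refine ⟨M, fun v s hs => ?_⟩
  set F : ℕ → ℕ := fun k => k.rec (f v.tail) fun y IH => g (y ::ᵥ IH ::ᵥ v.tail) with hF
  let Inv : ℕ → RegState → Prop := fun k m =>
    m.1 b = s.1 0 + k ∧ m.1 (b + 1) = s.1 0 + F k ∧ ∀ r < b, m.1 r = s.1 r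
  have hb : 0 < b := ho.trans hob
  let s₁ : RegState := (Function.update s.1 b (s.1 0 + 0), s.1 0 + 0)
  have hs₁ : ∀ r < b, s₁.1 r = s.1 r := fun r hr => Function.update_of_ne hr.ne _ _
  have hin : ∀ i, s₁.1 (xs i.succ) = s₁.1 0 + v.tail.get i := fun i => by
    rw [hs₁ _ (hxs _), hs₁ _ hb, hs]; simp
  have hinit : ∀ m, A.Run s₁ m → Inv 0 m := by
    intro m hm
    obtain ⟨h1, h2⟩ := (hA.run hin).1 m hm
    refine ⟨?_, ?_, fun r hr => ?_⟩
    · rw [h2 b (by omega) (by omega)]; simp [s₁]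
    · rw [h1, hs₁ _ hb]; rfl
    · rw [h2 r (by omega) (by omega), hs₁ r hr]
  have hbody : ∀ k m, Inv k m → (∀ m', (B.seq (.move b b 1)).Run m m' → Inv (k + 1) m') ∧
      ∃ m', (B.seq (.move b b 1)).Run m m' := by
    rintro k m ⟨h1, h2, h3⟩
    have hm : ∀ i, m.1 (Fin.cons (α := fun _ => ℕ) b (Fin.cons (α := fun _ => ℕ) (b + 1)
        fun i => xs i.succ) i) = m.1 0 + (k ::ᵥ F k ::ᵥ v.tail).get i := by
      intro i
      rw [h3 _ hb]
      refine Fin.cases (by simp [h1]) (fun i => Fin.cases (by simp [h2]; rfl) (fun i => ?_) i) i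
      simp [h3 _ (hxs _), hs]
    obtain ⟨hB1, m₁, hm₁⟩ := hB.run hm
    refine ⟨fun m' hm' => ?_, _, Net.run_seq.2 ⟨m₁, hm₁, Net.run_move.2 rfl⟩⟩
    obtain ⟨m₂, hm₂, h⟩ := Net.run_seq.1 hm'
    obtain ⟨hy1, hy2⟩ := hB1 m₂ hm₂
    obtain rfl := Net.run_move.1 h
    refine ⟨?_, ?_, fun r hr => ?_⟩
    · simp [hy2 b (by omega) (by omega), h1, add_assoc]
    · simp [hy1, h3 _ hb, hF]
    · simp [hr.ne, hy2 r (by omega) (by omega), h3 r hr]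
  have hfin : ∀ k m, Inv k m → v.head = k → ∀ m',
      m' = (Function.update m.1 o (m.1 (b + 1) + 0), m.1 (b + 1) + 0) →
      Stored s m' o b (F v.head) := by
    rintro k m ⟨h1, h2, h3⟩ rfl m' rfl
    refine ⟨by simp [h2], fun r hr hro => by simp [hro, h3 r hr]⟩
  have htest : ∀ k m, Inv k m → ((m.1 b : ℤ) - m.1 (xs 0) ∈ (IntInterval.point 0).toSet ↔
      v.head = k) := by
    rintro k m ⟨h1, h2, h3⟩
    rw [IntInterval.mem_point, h1, h3 _ (hxs _), hs, List.Vector.get_zero]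
    push_cast
    omega
  simp only [Part.mem_some_iff, exists_eq_left, forall_eq]
  have hsound : ∀ s', M.Run s s' → Stored s s' o b (F v.head) := by
    intro s' h
    obtain ⟨m₁, h1, h⟩ := Net.run_seq.1 h
    obtain rfl := Net.run_move.1 h1
    obtain ⟨m₂, h2, h⟩ := Net.run_seq.1 h
    obtain ⟨m₃, h3, h⟩ := Net.run_loop.1 h
    have hI : ∃ k, Inv k m₃ := by
      clear h
      induction h3 with
      | refl => exact ⟨0, hinit _ h2⟩
      | tail _ h ih =>
        obtain ⟨k, hk⟩ := ih
        exact ⟨k + 1, (hbody k _ hk).1 _ h⟩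
    obtain ⟨k, hk⟩ := hI
    obtain ⟨m₄, h4, h5⟩ := Net.run_seq.1 h
    obtain ⟨rfl, h6⟩ := Net.run_test.1 h4
    exact hfin k m₃ hk ((htest k m₃ hk).1 h6) s'
      (Net.run_move (σ := (m₃.1, m₃.1 b)).1 h5)
  refine ⟨hsound, ?_⟩
  obtain ⟨m₂, h2⟩ := (hA.run hin).2
  have hreach : ∀ k, ∃ m, Relation.ReflTransGen (B.seq (.move b b 1)).Run m₂ m ∧ Inv k m := by
    intro k
    induction k with
    | zero => exact ⟨m₂, .refl, hinit _ h2⟩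
    | succ k ih =>
      obtain ⟨m, h, hm⟩ := ih
      obtain ⟨hm1, m', hm'⟩ := hbody k m hm
      exact ⟨m', h.tail hm', hm1 _ hm'⟩
  obtain ⟨m, h3, hm⟩ := hreach v.head
  have hrun := Net.run_seq.2 ⟨_, Net.run_move.2 rfl, Net.run_seq.2 ⟨m₂, h2, Net.run_loop.2
    ⟨m, h3, Net.run_seq.2 ⟨_, Net.run_test.2 ⟨rfl, (htest _ m hm).2 rfl⟩,
      Net.run_move (r := o) (c := 0) (s := b + 1) |>.2 rfl⟩⟩⟩⟩
  exact ⟨_, hrun, hsound _ hrun⟩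

/-- Each pass of the loop evaluates `f` at the counter `b` and requires a positive value; the exit
evaluates it again and requires zero. The positivity tests force minimality, and without a zero no
run can exit. -/
theorem Programmable.rfind {n : ℕ} {f : List.Vector ℕ (n + 1) → ℕ}
    (hf : Programmable fun v => Part.some (f v)) :
    Programmable fun v : List.Vector ℕ n => Nat.rfind fun k => Part.some (f (k ::ᵥ v) = 0) := by
  intro xs o b hxs ho hob
  obtain ⟨A, hA⟩ := hf (Fin.cons b xs) (b + 1) (b + 2)
    (by
      intro i
      refine Fin.cases (by simp) (fun i => ?_) i
      simpa using (hxs _).trans (by omega))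
    (by omega) (by omega)
  refine ⟨(Net.move 0 b 0).seq ((A.seq ((Net.test 0 (b + 1) .pos).seq (.move b b 1))).loop
    (A.seq ((Net.test 0 (b + 1) (.point 0)).seq (.move b o 0)))), fun v s hs => ?_⟩
  have hb : 0 < b := ho.trans hob
  have hrf : ∀ y, y ∈ (Nat.rfind fun k => Part.some (decide (f (k ::ᵥ v) = 0))) ↔
      f (y ::ᵥ v) = 0 ∧ ∀ j < y, f (j ::ᵥ v) ≠ 0 := by
    intro y
    exact Nat.mem_rfind.trans (by simp [eq_comm])
  let Inv : ℕ → RegState → Prop := fun k m =>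
    m.1 b = s.1 0 + k ∧ (∀ j < k, f (j ::ᵥ v) ≠ 0) ∧ ∀ r < b, m.1 r = s.1 r
  let s₁ : RegState := (Function.update s.1 b (s.1 0 + 0), s.1 0 + 0)
  have hinit : Inv 0 s₁ :=
    ⟨by simp [s₁], by simp, fun r hr => Function.update_of_ne hr.ne _ _⟩
  have heval : ∀ k m, Inv k m → (∀ m', A.Run m m' → Inv k m' ∧
      ((m'.1 (b + 1) : ℤ) - m'.1 0 = f (k ::ᵥ v))) ∧ ∃ m', A.Run m m' := by
    rintro k m ⟨h1, h2, h3⟩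
    have hm : ∀ i, m.1 (Fin.cons (α := fun _ => ℕ) b xs i) = m.1 0 + (k ::ᵥ v).get i := by
      intro i
      rw [h3 _ hb]
      refine Fin.cases (by simp [h1]) (fun i => ?_) i
      simp [h3 _ (hxs _), hs]
    obtain ⟨hA1, hA2⟩ := hA.run hm
    refine ⟨fun m' hm' => ?_, hA2⟩
    obtain ⟨hy1, hy2⟩ := hA1 m' hm'
    refine ⟨⟨?_, h2, fun r hr => ?_⟩, ?_⟩
    · rw [hy2 b (by omega) (by omega), h1]
    · rw [hy2 r (by omega) (by omega), h3 r hr]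
    · rw [hy1, hy2 0 (by omega) (by omega)]; push_cast; omega
  have hstep : ∀ k m, Inv k m → f (k ::ᵥ v) ≠ 0 →
      Inv (k + 1) (Function.update m.1 b (m.1 b + 1), m.1 b + 1) := by
    rintro k m ⟨h1, h2, h3⟩ hk
    refine ⟨by simp [h1, add_assoc], fun j hj => ?_, fun r hr => by simp [hr.ne, h3 r hr]⟩
    rcases Nat.lt_succ_iff_lt_or_eq.1 hj with hj | rfl
    exacts [h2 j hj, hk]
  constructor
  · intro s' h
    obtain ⟨m₁, h1, h⟩ := Net.run_seq.1 h
    obtain rfl := Net.run_move.1 h1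
    obtain ⟨m₃, h3, h⟩ := Net.run_loop.1 h
    have hI : ∃ k, Inv k m₃ := by
      clear h
      induction h3 with
      | refl => exact ⟨0, hinit⟩
      | tail _ h ih =>
        obtain ⟨k, hk⟩ := ih
        obtain ⟨m, hm, h⟩ := Net.run_seq.1 h
        obtain ⟨m', hm', h⟩ := Net.run_seq.1 h
        obtain ⟨rfl, hpos⟩ := Net.run_test.1 hm'
        obtain rfl := Net.run_move.1 h
        obtain ⟨hi, hv⟩ := (heval k _ hk).1 m hm
        refine ⟨k + 1, hstep k m hi fun h0 => ?_⟩
        rw [IntInterval.mem_pos, hv, h0] at hpos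
        simp at hpos
    obtain ⟨k, hk⟩ := hI
    obtain ⟨m₄, h4, h⟩ := Net.run_seq.1 h
    obtain ⟨m₅, h5, h6⟩ := Net.run_seq.1 h
    obtain ⟨rfl, h7⟩ := Net.run_test.1 h5
    obtain ⟨⟨i1, i2, i3⟩, hv⟩ := (heval k _ hk).1 _ h4
    rw [IntInterval.mem_point, hv] at h7
    refine ⟨k, (hrf k).2 ⟨by exact_mod_cast h7, i2⟩, ?_⟩
    obtain rfl := Net.run_move.1 h6
    exact ⟨by simp [i1], fun r hr hro => by simp [hro, i3 r hr]⟩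
  · intro y hy
    obtain ⟨hy0, hy1⟩ := (hrf y).1 hy
    have hreach : ∀ k ≤ y, ∃ m, Relation.ReflTransGen
        (A.seq ((Net.test 0 (b + 1) .pos).seq (.move b b 1))).Run s₁ m ∧ Inv k m := by
      intro k
      induction k with
      | zero => exact fun _ => ⟨s₁, .refl, hinit⟩
      | succ k ih =>
        intro hk
        obtain ⟨m, h, hm⟩ := ih (by omega)
        obtain ⟨hm1, m', hm'⟩ := heval k m hm
        obtain ⟨hi, hv⟩ := hm1 m' hm'
        have hne := hy1 k (by omega)
        refine ⟨_, h.tail (Net.run_seq.2 ⟨m', hm', Net.run_seq.2 ⟨_, Net.run_test.2 ⟨rfl, ?_⟩,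
          Net.run_move.2 rfl⟩⟩), hstep k m' hi hne⟩
        rw [IntInterval.mem_pos, hv]
        omega
    obtain ⟨m, h, hm⟩ := hreach y le_rfl
    obtain ⟨hm1, m', hm'⟩ := heval y m hm
    obtain ⟨⟨i1, i2, i3⟩, hv⟩ := hm1 m' hm'
    refine ⟨_, Net.run_seq.2 ⟨_, Net.run_move.2 rfl, Net.run_loop.2 ⟨m, h, Net.run_seq.2
      ⟨m', hm', Net.run_seq.2 ⟨_, Net.run_test.2 ⟨rfl, ?_⟩, Net.run_move.2 rfl⟩⟩⟩⟩, ?_⟩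
    · rw [IntInterval.mem_point, hv, hy0]; rfl
    · exact ⟨by simp [i1], fun r hr hro => by simp [hro, i3 r hr]⟩

theorem programmable_of_primrec {n : ℕ} {f : List.Vector ℕ n → ℕ} (hf : Nat.Primrec' f) :
    Programmable fun v => Part.some (f v) := by
  induction hf with
  | zero => exact .zero
  | succ => exact .succ
  | get i => exact .get i
  | comp g _ _ ihf ihg =>
    have := Programmable.comp _ ihf ihg
    simpa [Vector.mOfFn_part_some] using this
  | prec _ _ ihf ihg => exact .prec ihf ihg

theorem programmable_of_partrec {n : ℕ} {f : List.Vector ℕ n →. ℕ} (hf : Nat.Partrec' f) :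
    Programmable f := by
  induction hf with
  | prim hf => exact programmable_of_primrec hf
  | comp g _ _ ihf ihg => exact .comp g ihf ihg
  | rfind _ ihf => exact .rfind ihf

/-- Every partial recursive function has a register automaton that has a run, from register
`1` containing `n` and the other registers containing `0`, if and only if `f n` is defined. -/
theorem exists_net_dom {f : ℕ →. ℕ} (hf : Partrec f) :
    ∃ N : Net, ∀ n d : ℕ,
      (∃ s', N.Run (Function.update (fun _ => d) 1 (d + n), d) s') ↔ (f n).Dom := by
  obtain ⟨N, hN⟩ := programmable_of_partrec (Nat.Partrec'.part_iff₁.2 hf)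
    (fun _ => 1) 2 3 (by simp) (by simp) (by simp)
  refine ⟨N, fun n d => ?_⟩
  obtain ⟨h1, h2⟩ := hN (n ::ᵥ .nil) (Function.update (fun _ => d) 1 (d + n), d)
    (fun i => by fin_cases i; simp)
  constructor
  · rintro ⟨s', hs'⟩
    obtain ⟨y, hy, -⟩ := h1 s' hs'
    exact Part.dom_iff_mem.2 ⟨y, by simpa using hy⟩
  · intro h
    obtain ⟨y, hy⟩ := Part.dom_iff_mem.1 h
    obtain ⟨s', hs', -⟩ := h2 y (by simpa using hy)
    exact ⟨s', hs'⟩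

end DataLogic

namespace DataLogic

variable {P : Type*}

/-! ### Suffixes and extensions of data words -/

/-- The suffix of `w` from position `c` on. -/
def DataWord.suf (w : DataWord P) (c : ℕ) : DataWord P := fun j => w (j + c)

/-- The data word `w` preceded by the letter `x`. -/
def DataWord.cons (x : Set P × ℕ) (w : DataWord P) : DataWord P
  | 0 => x
  | i + 1 => w i

@[simp] theorem DataWord.suf_zero (w : DataWord P) : w.suf 0 = w := rfl

theorem DataWord.suf_suf (w : DataWord P) (c d : ℕ) : (w.suf c).suf d = w.suf (d + c) := by
  funext j
  simp [suf, add_assoc]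

@[simp] theorem DataWord.suf_cons_succ (x : Set P × ℕ) (w : DataWord P) (i : ℕ) :
    (DataWord.cons x w).suf (i + 1) = w.suf i := rfl

@[simp] theorem DataWord.cons_zero (x : Set P × ℕ) (w : DataWord P) : DataWord.cons x w 0 = x := rfl

@[simp] theorem DataWord.cons_succ (x : Set P × ℕ) (w : DataWord P) (i : ℕ) :
    DataWord.cons x w (i + 1) = w i := rfl

theorem exists_add_iff {i c : ℕ} {q : ℕ → Prop} :
    (∃ j, i + c < j ∧ q j) ↔ ∃ j, i < j ∧ q (j + c) := by
  constructor
  · rintro ⟨j, hj, h⟩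
    refine ⟨j - c, by omega, ?_⟩
    rwa [Nat.sub_add_cancel (by omega)]
  · rintro ⟨j, hj, h⟩
    exact ⟨j + c, by omega, h⟩

theorem forall_between_add_iff {i j c : ℕ} {q : ℕ → Prop} :
    (∀ k, i + c < k → k < j + c → q k) ↔ ∀ k, i < k → k < j → q (k + c) := by
  constructor
  · exact fun h k h1 h2 => h _ (by omega) (by omega)
  · intro h k h1 h2
    have := h (k - c) (by omega) (by omega)
    rwa [Nat.sub_add_cancel (by omega)] at this

theorem MTL.sat_suf (w : DataWord P) (φ : MTL P) (i c : ℕ) :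
    φ.Sat (w.suf c) i ↔ φ.Sat w (i + c) := by
  induction φ generalizing i with
  | prop p => rfl
  | neg φ ih => simp only [Sat, ih]
  | and φ ψ ih1 ih2 => simp only [Sat, ih1, ih2]
  | untl I φ ψ ih1 ih2 =>
    simp only [Sat, ih1, ih2, exists_add_iff (i := i), forall_between_add_iff (i := i)]
    rfl

/-! ### Derived connectives of MTL -/

namespace MTL

def or (φ ψ : MTL P) : MTL P := .neg (.and (.neg φ) (.neg ψ))

def ff (p : P) : MTL P := .and (.prop p) (.neg (.prop p))

def tt (p : P) : MTL P := .neg (ff p)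

/-- `X_I φ`. -/
def next (p : P) (I : IntInterval) (φ : MTL P) : MTL P := .untl I (ff p) φ

/-- `F φ`. -/
def eventually (p : P) (φ : MTL P) : MTL P := .untl .all (tt p) φ

open Classical in
/-- `φ` if `q` holds, and `False` otherwise. -/
noncomputable def guard (p : P) (q : Prop) (φ : MTL P) : MTL P := if q then φ else ff p

/-- The disjunction of the formulas `f t`. -/
noncomputable def any (p : P) {T : Type} (hT : Finite T) (f : T → MTL P) : MTL P :=
  ((@Fintype.ofFinite T hT).elems.toList.map f).foldr or (ff p)

variable {w : DataWord P} {i : ℕ} {p : P}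

@[simp] theorem sat_prop : (prop p).Sat w i ↔ p ∈ (w i).1 := Iff.rfl

@[simp] theorem sat_neg {φ : MTL P} : (neg φ).Sat w i ↔ ¬ φ.Sat w i := Iff.rfl

@[simp] theorem sat_and {φ ψ : MTL P} : (and φ ψ).Sat w i ↔ φ.Sat w i ∧ ψ.Sat w i := Iff.rfl

@[simp] theorem sat_or {φ ψ : MTL P} : (or φ ψ).Sat w i ↔ φ.Sat w i ∨ ψ.Sat w i := by
  simp only [or, Sat]; tauto

@[simp] theorem sat_ff : (ff p).Sat w i ↔ False := by simp [ff]

@[simp] theorem sat_tt : (tt p).Sat w i ↔ True := by simp [tt]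

@[simp] theorem sat_next {I : IntInterval} {φ : MTL P} :
    (next p I φ).Sat w i ↔ φ.Sat w (i + 1) ∧ w.val (i + 1) - w.val i ∈ I.toSet := by
  simp only [next, Sat, sat_ff]
  constructor
  · rintro ⟨j, hij, hφ, hI, h⟩
    obtain rfl : j = i + 1 := by
      by_contra hne
      exact h (i + 1) (by omega) (by omega)
    exact ⟨hφ, hI⟩
  · rintro ⟨hφ, hI⟩
    exact ⟨i + 1, by omega, hφ, hI, fun k h1 h2 => by omega⟩

@[simp] theorem sat_eventually {φ : MTL P} :
    (eventually p φ).Sat w i ↔ ∃ j, i < j ∧ φ.Sat w j := by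
  simp [eventually, Sat]

@[simp] theorem sat_guard {q : Prop} {φ : MTL P} : (guard p q φ).Sat w i ↔ q ∧ φ.Sat w i := by
  by_cases h : q <;> simp [guard, h]

@[simp] theorem sat_any {T : Type} {hT : Finite T} {f : T → MTL P} :
    (any p hT f).Sat w i ↔ ∃ t, (f t).Sat w i := by
  have : ∀ l : List (MTL P), (l.foldr or (ff p)).Sat w i ↔ ∃ φ ∈ l, φ.Sat w i := by
    intro l
    induction l with
    | nil => simp
    | cons a l ih => simp [ih]
  have hmem : ∀ t, t ∈ (@Fintype.ofFinite T hT).elems := (@Fintype.ofFinite T hT).complete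
  simp [any, this, hmem]

end MTL

/-! ### Data words that describe runs of register automata -/

section Encoding

variable (N : Net) (e : N.Node → ℕ) (p : P)

/-- The word starts with the event of node `t`: the proposition `p` marks the first
position, and the difference of the first two data values is the number of the node. -/
def Ev (u : DataWord P) (t : N.Node) : Prop := p ∈ (u 0).1 ∧ u.val 1 - u.val 0 = e t

/-- The word starts with an event that writes to (reads from) register `r`. -/
def Access (b : Bool) (r : ℕ) (u : DataWord P) : Prop :=
  ∃ t, ((N.event t).write = b ∧ (N.event t).reg = r) ∧ Ev N e p u t

/-- All read events for register `r` before the first write event for `r` have the value `c`. -/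
def Reads (u : DataWord P) (r : ℕ) (c : ℤ) : Prop :=
  ∀ j, Access N e p false r (u.suf j) → (∀ k < j, ¬ Access N e p true r (u.suf k)) → u.val j = c

def NextEv (u : DataWord P) (t : N.Node) : Prop :=
  ∃ j, 0 < j ∧ Ev N e p (u.suf j) t ∧ u.val j - u.val 0 ∈ (N.event t).gap.toSet ∧
    ∀ k, 0 < k → k < j → p ∉ (u k).1

/-- The word has no memory, so each write has to fix the value of all reads up to the next write to
that register. -/
def EvOk (u : DataWord P) : Prop :=
  ∃ t, Ev N e p u t ∧
    ((N.event t).write = true → Reads N e p (u.suf 1) (N.event t).reg (u.val 0)) ∧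
    (N.last t ∨ ∃ t', N.follow t t' ∧ NextEv N e p u t')

/-- Positions 0 and 1 carry no event and act as initial writes: the value of position 1 goes to
register 1, that of position 0 to all other registers. -/
def Encodes (w : DataWord P) (n : ℕ) : Prop :=
  w.val 1 - w.val 0 = n ∧ p ∉ (w 0).1 ∧
    (∀ t, (N.event t).reg ≠ 1 → Reads N e p (w.suf 1) (N.event t).reg (w.val 0)) ∧
    p ∉ (w 1).1 ∧ Reads N e p (w.suf 2) 1 (w.val 1) ∧ (∃ t, N.first t ∧ NextEv N e p w t) ∧
    (∀ i, 0 < i → p ∈ (w i).1 → EvOk N e p (w.suf i)) ∧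
    ∃ i, 0 < i ∧ ∃ t, N.last t ∧ Ev N e p (w.suf i) t

variable {N e p}

theorem Ev.unique (he : Function.Injective e) {u : DataWord P} {t t' : N.Node}
    (h : Ev N e p u t) (h' : Ev N e p u t') : t = t' :=
  he (by have := h.2; have := h'.2; omega)

theorem Access.of_ev (he : Function.Injective e) {u : DataWord P} {t : N.Node} {b : Bool} {r : ℕ}
    (h : Ev N e p u t) (h' : Access N e p b r u) :
    (N.event t).write = b ∧ (N.event t).reg = r := by
  obtain ⟨t', h1, h2⟩ := h'
  rwa [h.unique he h2]

open Classical in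
/-- The contents of the registers before position `i` of a data word. -/
noncomputable def contents (N : Net) (e : N.Node → ℕ) (p : P) (w : DataWord P) (ν : ℕ → ℕ) :
    ℕ → ℕ → ℕ
  | 0 => ν
  | i + 1 => fun r => if Access N e p true r (w.suf i) then (w i).2 else contents N e p w ν i r

theorem contents_eq {w : DataWord P} {ν : ℕ → ℕ} {i j : ℕ} (hij : i ≤ j)
    (h : ∀ k, i ≤ k → k < j → p ∉ (w k).1) : contents N e p w ν j = contents N e p w ν i := by
  induction j, hij using Nat.le_induction with
  | base => rfl
  | succ j hij ih =>
    rw [← ih fun k h1 h2 => h k h1 (by omega)]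
    funext r
    refine if_neg ?_
    rintro ⟨t, -, ht, -⟩
    exact h j hij (by omega) (by simpa [DataWord.suf] using ht)

/-- `NextEv` skips no position marked by `p`. Following it from the first event therefore either
meets a last node early or arrives at `f`, whose node is last; what the word contains beyond is
irrelevant. -/
theorem Encodes.exists_run (he : Function.Injective e) {w : DataWord P} {n : ℕ}
    (h : Encodes N e p w n) :
    ∃ d s', N.Run (Function.update (fun _ => d) 1 (d + n), d) s' := by
  obtain ⟨hn, hp0, hR0, hp1, hR1, ⟨t₀, ht₀, j₀, hj₀, hev₀, hgap₀, hno₀⟩, hok, f, hf, tf, htf,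
    hevf⟩ := h
  set d := (w 0).2 with hd
  set ν : ℕ → ℕ := Function.update (fun _ => d) 1 (d + n) with hν
  let C := contents N e p w ν
  have hn' : (w 1).2 = d + n := by simp only [DataWord.val] at hn; omega
  have hpev : ∀ {i t}, Ev N e p (w.suf i) t → p ∈ (w i).1 := by
    rintro i t ⟨h, -⟩
    simpa [DataWord.suf] using h
  have hpacc : ∀ {b r i}, Access N e p b r (w.suf i) → p ∈ (w i).1 := by
    rintro b r i ⟨t, -, h⟩
    exact hpev h
  have hC2 : C 2 = ν := contents_eq (i := 0) (by omega) fun k _ hk => by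
    interval_cases k <;> assumption
  -- The content of each register used comes from a position `k` (0 or 1 for initial contents) whose
  -- demand on later reads is still in force, as no write intervenes. Hence reads see the right
  -- value.
  have horig : ∀ i, 2 ≤ i → ∀ t, ∃ k < i, C i (N.event t).reg = (w k).2 ∧
      Reads N e p (w.suf (k + 1)) (N.event t).reg (w.val k) ∧
      ∀ l, k < l → l < i → ¬ Access N e p true (N.event t).reg (w.suf l) := by
    intro i hi
    induction i, hi using Nat.le_induction with
    | base =>
      intro t
      by_cases hr : (N.event t).reg = 1
      · exact ⟨1, by omega, by simp [hC2, hν, hr, hn'], by rw [hr]; exact hR1,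
          fun l h1 h2 => by omega⟩
      · refine ⟨0, by omega, by simp [hC2, hν, hr, hd], hR0 t hr, fun l h1 h2 h => ?_⟩
        obtain rfl : l = 1 := by omega
        exact hp1 (hpacc h)
    | succ i hi ih =>
      intro t
      by_cases hacc : Access N e p true (N.event t).reg (w.suf i)
      · refine ⟨i, by omega, if_pos hacc, ?_, fun l h1 h2 => by omega⟩
        obtain ⟨t', ht', hw, -⟩ := hok i (by omega) (hpacc hacc)
        obtain ⟨h1, h2⟩ := hacc.of_ev he ht'
        rw [← h2]
        have := hw h1
        rw [DataWord.suf_suf] at this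
        rw [add_comm i 1]
        simpa [DataWord.val, DataWord.suf] using this
      · obtain ⟨k, hk, h1, h2, h3⟩ := ih t
        refine ⟨k, by omega, (if_neg hacc).trans h1, h2, fun l hl1 hl2 => ?_⟩
        rcases Nat.lt_succ_iff_lt_or_eq.1 hl2 with hl | rfl
        exacts [h3 l hl1 hl, hacc]
  have hexec : ∀ i, 2 ≤ i → ∀ t, Ev N e p (w.suf i) t → ∀ a : ℕ,
      w.val i - a ∈ (N.event t).gap.toSet →
      (N.event t).Exec (C i, a) (C (i + 1), (w i).2) := by
    intro i hi t ht a ha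
    refine ⟨ha, ?_⟩
    cases hwr : (N.event t).write with
    | true =>
      refine .inl ⟨rfl, ?_⟩
      funext r
      by_cases hr : r = (N.event t).reg
      · subst hr
        exact (if_pos ⟨t, ⟨hwr, rfl⟩, ht⟩).trans (by simp)
      · exact (if_neg fun h => hr (h.of_ev he ht).2.symm).trans (Function.update_of_ne hr ..).symm
    | false =>
      refine .inr ⟨rfl, ?_, ?_⟩
      · funext r
        refine if_neg fun h => ?_
        simp [(h.of_ev he ht).1] at hwr
      · obtain ⟨k, hk, h1, h2, h3⟩ := horig i hi t
        have := h2 (i - (k + 1)) (by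
            rw [DataWord.suf_suf, Nat.sub_add_cancel hk]
            exact ⟨t, ⟨hwr, rfl⟩, ht⟩)
          fun l hl => by
            rw [DataWord.suf_suf]
            exact h3 _ (by omega) (by omega)
        simp only [DataWord.val, DataWord.suf, Nat.sub_add_cancel hk] at this
        change _ = C i _
        rw [h1]
        exact_mod_cast this
  -- Induction on the distance to `f`; `a` is the value produced by the previous event.
  have hgo : ∀ m i, 2 ≤ i → i + m = f → ∀ t, Ev N e p (w.suf i) t → ∀ a : ℕ,
      w.val i - a ∈ (N.event t).gap.toSet → ∃ s', N.Go t (C i, a) s' := by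
    intro m
    induction m using Nat.strong_induction_on with
    | _ m ih =>
      intro i hi him t ht a ha
      have hE := hexec i hi t ht a ha
      by_cases hl : N.last t
      · exact ⟨_, .last hE hl⟩
      have hif : i < f := by
        rcases Nat.eq_zero_or_pos m with rfl | hm
        · obtain rfl : i = f := him
          exact (hl (ht.unique he hevf ▸ htf)).elim
        · omega
      obtain ⟨t₁, ht₁, -, h⟩ := hok i (by omega) (hpev ht)
      obtain rfl := ht₁.unique he ht
      obtain ⟨t', hfol, j, hj, hj1, hj2, hj3⟩ := h.resolve_left hl
      rw [DataWord.suf_suf] at hj1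
      have hno : ∀ k, i + 1 ≤ k → k < j + i → p ∉ (w k).1 := by
        intro k h1 h2
        have := hj3 (k - i) (by omega) (by omega)
        rwa [DataWord.suf, Nat.sub_add_cancel (by omega)] at this
      have hjf : j + i ≤ f := by
        by_contra hlt
        exact hno f hif (by omega) (hpev hevf)
      obtain ⟨s', hs'⟩ := ih (f - (j + i)) (by omega) (j + i) (by omega) (by omega) t' hj1 (w i).2
        (by simpa [DataWord.val, DataWord.suf] using hj2)
      rw [show C (j + i) = C (i + 1) from contents_eq (by omega) hno] at hs'
      exact ⟨s', .step hE hfol hs'⟩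
  have hj2 : 2 ≤ j₀ := by
    by_contra hlt
    obtain rfl : j₀ = 1 := by omega
    exact hp1 (hpev hev₀)
  have hjf : j₀ ≤ f := by
    by_contra hlt
    exact hno₀ f hf (by omega) (hpev hevf)
  obtain ⟨s', hs'⟩ := hgo (f - j₀) j₀ hj2 (by omega) t₀ hev₀ d hgap₀
  have hCj : C j₀ = C 2 := contents_eq hj2 fun k h1 h2 => hno₀ k (by omega) h2
  rw [hCj, hC2] at hs'
  exact ⟨d, s', t₀, ht₀, hs'⟩

/-- The word that starts with the event of a node with number `c` and with data value `v`. -/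
def block (p : P) (v c : ℕ) (u : DataWord P) : DataWord P :=
  .cons ({p}, v) (.cons (∅, v + c) u)

theorem reads_cons {x : Set P × ℕ} (hx : p ∉ x.1) {u : DataWord P} {r : ℕ} {c : ℤ}
    (h : Reads N e p u r c) : Reads N e p (.cons x u) r c := by
  rintro (_ | j) hj hk
  · obtain ⟨t, -, ht⟩ := hj
    exact (hx ht.1).elim
  · exact h j hj fun k hkj => hk (k + 1) (by omega)

theorem ev_block {v : ℕ} {u : DataWord P} {t : N.Node} : Ev N e p (block p v (e t) u) t := by
  refine ⟨by simp [block], ?_⟩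
  simp [DataWord.val, block, DataWord.cons]

/-- The word of a run is built from its end. Reads in `u` agree with the registers after the step;
once the event is prepended they agree with those before it. A write shields its register from the
old content, and all other registers are unchanged. -/
theorem evOk_block (he : Function.Injective e) {t : N.Node} {s s₁ : RegState}
    (hE : (N.event t).Exec s s₁) {u : DataWord P}
    (hok : ∀ i, p ∈ (u i).1 → EvOk N e p (u.suf i)) (hR : ∀ r, Reads N e p u r (s₁.1 r))
    (hf : N.last t ∨ ∃ t', N.follow t t' ∧ Ev N e p u t' ∧
      u.val 0 - s₁.2 ∈ (N.event t').gap.toSet) :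
    (∀ i, p ∈ (block p s₁.2 (e t) u i).1 → EvOk N e p ((block p s₁.2 (e t) u).suf i)) ∧
      ∀ r, Reads N e p (block p s₁.2 (e t) u) r (s.1 r) := by
  have hev : Ev N e p (block p s₁.2 (e t) u) t := ev_block
  constructor
  · rintro (_ | _ | i) hi
    · refine ⟨t, hev, fun hw => ?_, hf.imp id ?_⟩
      · obtain ⟨-, ⟨-, h⟩ | ⟨h, -⟩⟩ := hE
        · have := hR (N.event t).reg
          rw [h, Function.update_self] at this
          exact reads_cons (by simp) this
        · simp [h] at hw
      · rintro ⟨t', h1, h2, h3⟩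
        refine ⟨t', h1, 2, by omega, h2, h3, fun k hk1 hk2 => ?_⟩
        obtain rfl : k = 1 := by omega
        exact Set.notMem_empty p
    · exact (Set.notMem_empty p hi).elim
    · exact hok i hi
  · intro r
    rintro (_ | _ | j) hj hk
    · obtain ⟨h1, h2⟩ := hj.of_ev he hev
      obtain ⟨-, ⟨h, -⟩ | ⟨-, -, h⟩⟩ := hE
      · simp [h] at h1
      · rw [← h2, ← h]; rfl
    · obtain ⟨t', -, ht'⟩ := hj
      exact (Set.notMem_empty p ht'.1).elim
    · have hs : s.1 r = s₁.1 r := by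
        obtain ⟨-, ⟨h1, h2⟩ | ⟨-, h, -⟩⟩ := hE
        · rw [h2, Function.update_of_ne]
          rintro rfl
          exact hk 0 (by omega) ⟨t, ⟨h1, rfl⟩, hev⟩
        · rw [h]
      rw [hs]
      exact hR r j hj fun k hkj => hk (k + 2) (by omega)

theorem Net.Go.exists_word (he : Function.Injective e) {t : N.Node} {s s' : RegState}
    (h : N.Go t s s') :
    ∃ u : DataWord P, Ev N e p u t ∧ u.val 0 - s.2 ∈ (N.event t).gap.toSet ∧
      (∀ i, p ∈ (u i).1 → EvOk N e p (u.suf i)) ∧ (∀ r, Reads N e p u r (s.1 r)) ∧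
      ∃ i t', N.last t' ∧ Ev N e p (u.suf i) t' := by
  induction h with
  | @last t s s' hE hl =>
    -- After the last event the word continues without `p`, so it contains no further events.
    obtain ⟨h1, h2⟩ := evOk_block (p := p) he hE (u := fun _ => (∅, 0)) (by simp)
      (fun r j hj => by obtain ⟨t, -, ht⟩ := hj; exact (Set.notMem_empty p ht.1).elim) (.inl hl)
    exact ⟨_, ev_block, hE.1, h1, h2, 0, t, hl, ev_block⟩
  | @step t t' s s₁ s' hE hf _ ih =>
    obtain ⟨u, hev, hgap, hok, hR, i, tl, hl, hevl⟩ := ih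
    obtain ⟨h1, h2⟩ := evOk_block he hE hok hR (.inr ⟨t', hf, hev, hgap⟩)
    exact ⟨_, ev_block, hE.1, h1, h2, i + 2, tl, hl, hevl⟩

theorem exists_encodes_iff (he : Function.Injective e) (n : ℕ) :
    (∃ w : DataWord P, Encodes N e p w n) ↔
      ∃ d s', N.Run (Function.update (fun _ => d) 1 (d + n), d) s' := by
  constructor
  · rintro ⟨w, h⟩
    exact h.exists_run he
  · rintro ⟨d, s', t, ht, h⟩
    obtain ⟨u, hev, hgap, hok, hR, i, tl, hl, hevl⟩ := h.exists_word (p := p) he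
    refine ⟨.cons (∅, d) (.cons (∅, d + n) u), ?_, Set.notMem_empty p, fun t hr => ?_,
      Set.notMem_empty p, ?_, ⟨t, ht, 2, by omega, hev, hgap, fun k h1 h2 => ?_⟩, ?_,
      i + 2, by omega, tl, hl, hevl⟩
    · simp [DataWord.val, DataWord.cons]
    · have := hR (N.event t).reg
      simp only [Function.update_of_ne hr] at this
      exact reads_cons (Set.notMem_empty p) this
    · simpa [DataWord.val] using hR 1
    · obtain rfl : k = 1 := by omega
      exact Set.notMem_empty p
    · rintro (_ | _ | i) h0 hi
      · omega
      · exact (Set.notMem_empty p hi).elim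
      · exact hok i hi

end Encoding

/-! ### The formula that describes halting runs -/

section Formula

variable (N : Net) (e : N.Node → ℕ) (p : P)

def evF (t : N.Node) : MTL P := .and (.prop p) (.next p (.point (e t)) (.tt p))

noncomputable def accessF (b : Bool) (r : ℕ) : MTL P :=
  .any p N.finite fun t => .guard p ((N.event t).write = b ∧ (N.event t).reg = r) (evF N e p t)

/-- Being nonzero is not an interval condition, so a wrong value is excluded separately below and
above. -/
noncomputable def readsF (r : ℕ) : MTL P :=
  .and (.neg (.untl .neg (.neg (accessF N e p true r)) (accessF N e p false r)))
    (.neg (.untl .pos (.neg (accessF N e p true r)) (accessF N e p false r)))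

def nextEvF (t : N.Node) : MTL P := .untl (N.event t).gap (.neg (.prop p)) (evF N e p t)

noncomputable def evOkF : MTL P :=
  .any p N.finite fun t => .and (evF N e p t) <| .and
    (.neg (.guard p ((N.event t).write = true) (.neg (readsF N e p (N.event t).reg))))
    (.or (.guard p (N.last t) (.tt p))
      (.any p N.finite fun t' => .guard p (N.follow t t') (nextEvF N e p t')))

/-- Negated disjunctions of guarded negations express bounded universal statements. The formula does
not involve the input, so the classical choices in `guard` and `any` do not affect computability of
the reduction. -/
noncomputable def runF : MTL P :=
  .and (.neg (.prop p)) <| .and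
  (.neg (.any p N.finite fun t => .guard p ((N.event t).reg ≠ 1)
    (.neg (readsF N e p (N.event t).reg)))) <| .and
  (.next p .all (.and (.neg (.prop p)) (readsF N e p 1))) <| .and
  (.any p N.finite fun t => .guard p (N.first t) (nextEvF N e p t)) <| .and
  (.neg (.eventually p (.and (.prop p) (.neg (evOkF N e p)))))
  (.eventually p (.any p N.finite fun t => .guard p (N.last t) (evF N e p t)))

/-- The MTL-formula for the data words that describe a halting run of `N` on input `n`. -/
noncomputable def haltF (n : ℕ) : MTL P := .and (.next p (.point n) (.tt p)) (runF N e p)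

variable {N e p} {w : DataWord P} {i : ℕ}

theorem sat_evF {t : N.Node} : (evF N e p t).Sat w i ↔ Ev N e p (w.suf i) t := by
  simp [evF, Ev, DataWord.val, DataWord.suf, add_comm]

theorem sat_accessF {b : Bool} {r : ℕ} :
    (accessF N e p b r).Sat w i ↔ Access N e p b r (w.suf i) := by
  simp [accessF, Access, sat_evF]

theorem sat_readsF {r : ℕ} :
    (readsF N e p r).Sat w i ↔ Reads N e p (w.suf (i + 1)) r (w.val i) := by
  have hval : ∀ j, (w.suf (i + 1)).val j = w.val (j + (i + 1)) := fun _ => rfl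
  simp only [readsF, MTL.sat_and, MTL.Sat, sat_accessF, Reads, DataWord.suf_suf,
    IntInterval.mem_neg, IntInterval.mem_pos, hval]
  constructor
  · rintro ⟨h1, h2⟩ j hj hk
    have hk' : ∀ k, i < k → k < j + (i + 1) → ¬ Access N e p true r (w.suf k) := by
      intro k h3 h4
      have := hk (k - (i + 1)) (by omega)
      rwa [Nat.sub_add_cancel (by omega)] at this
    by_contra hne
    rcases lt_or_gt_of_ne hne with h | h
    · exact h1 ⟨_, by omega, hj, by omega, hk'⟩
    · exact h2 ⟨_, by omega, hj, by omega, hk'⟩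
  · intro h
    have key : ∀ j, i < j → Access N e p false r (w.suf j) →
        (∀ k, i < k → k < j → ¬ Access N e p true r (w.suf k)) → w.val j = w.val i := by
      intro j hij hj hk
      have := h (j - (i + 1)) (by rwa [Nat.sub_add_cancel (by omega)])
        fun k hk' => hk _ (by omega) (by omega)
      rwa [Nat.sub_add_cancel (by omega)] at this
    constructor
    · rintro ⟨j, hij, hj, hlt, hk⟩
      have := key j hij hj hk
      omega
    · rintro ⟨j, hij, hj, hlt, hk⟩
      have := key j hij hj hk
      omega

theorem sat_nextEvF {t : N.Node} : (nextEvF N e p t).Sat w i ↔ NextEv N e p (w.suf i) t := by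
  rw [← Nat.zero_add i, ← MTL.sat_suf, Nat.zero_add]
  simp only [nextEvF, MTL.Sat, sat_evF, NextEv]

theorem sat_evOkF : (evOkF N e p).Sat w i ↔ EvOk N e p (w.suf i) := by
  simp [evOkF, EvOk, sat_evF, sat_readsF, sat_nextEvF, DataWord.suf_suf, DataWord.val,
    DataWord.suf, add_comm]

theorem sat_haltF {n : ℕ} : (haltF N e p n).Sat w 0 ↔ Encodes N e p w n := by
  simp [haltF, runF, Encodes, sat_evF, sat_readsF, sat_nextEvF, sat_evOkF, and_assoc]

theorem exists_sat_haltF_iff (he : Function.Injective e) (n : ℕ) :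
    (∃ w : DataWord P, (haltF N e p n).Sat w 0) ↔
      ∃ d s', N.Run (Function.update (fun _ => d) 1 (d + n), d) s' := by
  simp only [sat_haltF, exists_encodes_iff he]

end Formula

end DataLogic

namespace DataLogic

variable {P : Type*}

/-! ### Translation of MTL to TPTL -/

/-- The TPTL-formula that is equivalent to an MTL-formula. -/
def MTL.toTPTL : MTL P → TPTL P
  | .prop p => .prop p
  | .neg φ => .neg φ.toTPTL
  | .and φ ψ => .and φ.toTPTL ψ.toTPTL
  | .untl I φ ψ => .freeze 0 (.untl φ.toTPTL (.and (.cmp 0 I) ψ.toTPTL))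

/-- One register suffices: a translated formula never reads register 0 before freezing it, so `ν`
plays no role. -/
theorem MTL.sat_toTPTL (w : DataWord P) (φ : MTL P) (i : ℕ) (ν : ℕ → ℕ) :
    φ.toTPTL.Sat w i ν ↔ φ.Sat w i := by
  induction φ generalizing i ν with
  | prop p => rfl
  | neg φ ih => simp only [toTPTL, TPTL.Sat, Sat, ih]
  | and φ ψ ih1 ih2 => simp only [toTPTL, TPTL.Sat, Sat, ih1, ih2]
  | untl I φ ψ ih1 ih2 =>
    simp only [toTPTL, TPTL.Sat, Sat, ih1, ih2, Function.update_self]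
    refine exists_congr fun j => ?_
    simp only [DataWord.val]
    tauto

theorem MTL.lang_toTPTL (φ : MTL P) : φ.toTPTL.lang = φ.lang := by
  ext w
  exact φ.sat_toTPTL w 0 _

theorem MTL.urk_toTPTL (φ : MTL P) : φ.toTPTL.urk = φ.urk := by
  induction φ with
  | prop p => rfl
  | neg φ ih => exact ih
  | and φ ψ ih1 ih2 => simp only [toTPTL, TPTL.urk, urk, ih1, ih2]
  | untl I φ ψ ih1 ih2 => simp [toTPTL, TPTL.urk, urk, ih1, ih2]

namespace TPTL

theorem sat_suf (w : DataWord P) (φ : TPTL P) (i c : ℕ) (ν : ℕ → ℕ) :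
    φ.Sat (w.suf c) i ν ↔ φ.Sat w (i + c) ν := by
  induction φ generalizing i ν with
  | prop p => rfl
  | cmp x I => rfl
  | neg φ ih => simp only [Sat, ih]
  | and φ ψ ih1 ih2 => simp only [Sat, ih1, ih2]
  | untl φ ψ ih1 ih2 =>
    simp only [Sat, ih1, ih2, exists_add_iff (i := i), forall_between_add_iff (i := i)]
  | freeze x φ ih =>
    simp only [Sat, ih]
    rfl

theorem sat_iff_suf (w : DataWord P) (φ : TPTL P) (i : ℕ) (ν : ℕ → ℕ) :
    φ.Sat w i ν ↔ φ.Sat (w.suf i) 0 ν := by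
  rw [sat_suf, Nat.zero_add]

variable {w : DataWord P} {i : ℕ} {ν : ℕ → ℕ} {p : P}

theorem sat_tt : (tt p).Sat w i ν := by
  simp only [tt, or, Sat]; tauto

theorem sat_eventually {φ : TPTL P} :
    (eventually p φ).Sat w i ν ↔ ∃ j, i < j ∧ φ.Sat w j ν := by
  simp [eventually, Sat, sat_tt]

theorem sat_next {φ : TPTL P} : (next p φ).Sat w i ν ↔ φ.Sat w (i + 1) ν := by
  simp only [next, ff, Sat]
  constructor
  · rintro ⟨j, hij, hφ, h⟩
    obtain rfl : j = i + 1 := by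
      by_contra hne
      exact h (i + 1) (by omega) (by omega) sat_tt
    exact hφ
  · exact fun hφ => ⟨i + 1, by omega, hφ, fun k h1 h2 => by omega⟩

theorem urk_eventually {φ : TPTL P} : (eventually p φ).urk = φ.urk + 1 := by
  simp [eventually, tt, or, urk]

theorem urk_next {φ : TPTL P} : (next p φ).urk = φ.urk + 1 := by
  simp [next, ff, tt, or, urk]

end TPTL

/-! ### Repeated letters cannot be counted beyond the until rank -/

/-- The letter `σ` repeated `a` times, followed by `t`. -/
def DataWord.rep (σ : Set P × ℕ) (a : ℕ) (t : DataWord P) : DataWord P :=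
  fun i => if i < a then σ else t (i - a)

theorem DataWord.suf_rep_of_add_eq (σ : Set P × ℕ) (t : DataWord P) {a b i j : ℕ}
    (h : i + b = j + a) : (DataWord.rep σ a t).suf i = (DataWord.rep σ b t).suf j := by
  funext k
  simp only [suf, rep]
  by_cases hk : k + i < a
  · rw [if_pos hk, if_pos (by omega)]
  · rw [if_neg hk, if_neg (by omega), show k + i - a = k + j - b by omega]

theorem DataWord.suf_rep (σ : Set P × ℕ) (t : DataWord P) {a i : ℕ} (h : i ≤ a) :
    (DataWord.rep σ a t).suf i = DataWord.rep σ (a - i) t :=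
  suf_rep_of_add_eq (j := 0) σ t (by omega)

theorem DataWord.suf_rep_self (σ : Set P × ℕ) (t : DataWord P) (a : ℕ) :
    (DataWord.rep σ a t).suf a = t := by
  funext k
  simp [suf, rep]

theorem TPTL.sat_rep (σ : Set P × ℕ) (t : DataWord P) (φ : TPTL P) (ν : ℕ → ℕ) {a b : ℕ}
    (ha : φ.urk < a) (hb : φ.urk < b) (h : φ.Sat (.rep σ a t) 0 ν) :
    φ.Sat (.rep σ b t) 0 ν := by
  have h0 : ∀ {a : ℕ}, 0 < a → DataWord.rep σ a t 0 = σ := fun ha => if_pos ha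
  induction φ generalizing a b ν with
  | prop p =>
    simp only [urk] at ha hb
    simpa [Sat, h0 ha, h0 hb] using h
  | cmp x I =>
    simp only [urk] at ha hb
    simpa [Sat, DataWord.val, h0 ha, h0 hb] using h
  | neg φ ih => exact fun h' => h (ih ν hb ha h')
  | and φ ψ ih1 ih2 =>
    simp only [urk, sup_lt_iff] at ha hb
    exact ⟨ih1 ν ha.1 hb.1 h.1, ih2 ν ha.2 hb.2 h.2⟩
  | freeze x φ ih =>
    have := ih (Function.update ν x σ.2) ha hb
    simpa [Sat, h0 (Nat.zero_lt_of_lt ha), h0 (Nat.zero_lt_of_lt hb)] using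
      this (by simpa [Sat, h0 (Nat.zero_lt_of_lt ha)] using h)
  | untl φ ψ ih1 ih2 =>
    set K := max φ.urk ψ.urk with hK
    replace ha : K + 1 < a := ha
    replace hb : K + 1 < b := hb
    have hφ : φ.urk ≤ K := le_max_left _ _
    have hψ : ψ.urk ≤ K := le_max_right _ _
    -- Two positions match if they have the same distance to `t`, making the suffixes equal, or if
    -- both have more than `K` copies of `σ` ahead.
    have key : ∀ {i j : ℕ}, (i + b = j + a ∨ i + K < a ∧ j + K < b) →
        (φ.Sat (.rep σ a t) i ν → φ.Sat (.rep σ b t) j ν) ∧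
        (ψ.Sat (.rep σ a t) i ν → ψ.Sat (.rep σ b t) j ν) := by
      rintro i j (hij | ⟨hi, hj⟩)
      · simp only [sat_iff_suf _ _ i, sat_iff_suf _ _ j, DataWord.suf_rep_of_add_eq σ t hij,
          imp_self, and_self]
      · simp only [sat_iff_suf _ _ i, sat_iff_suf _ _ j]
        rw [DataWord.suf_rep σ t (by omega), DataWord.suf_rep σ t (by omega)]
        exact ⟨ih1 ν (by omega) (by omega), ih2 ν (by omega) (by omega)⟩
    obtain ⟨j, hj, hj1, hj2⟩ := h
    by_cases hja : j + K < a
    -- A witness with more than `K` copies ahead is answered by position 1, with nothing in between.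
    · exact ⟨1, by omega, (key (.inr ⟨hja, by omega⟩)).2 hj1, fun k h1 h2 => by omega⟩
    -- Otherwise the answer keeps the distance to `t`. Positions in between without a partner at
    -- equal distance are matched with position 1, which lies before `j`.
    · refine ⟨j + b - a, by omega, (key (.inl (by omega))).2 hj1, fun k h1 h2 => ?_⟩
      by_cases hk : b + 1 ≤ k + a
      · exact (key (i := k + a - b) (.inl (by omega))).1 (hj2 _ (by omega) (by omega))
      · exact (key (i := 1) (.inr ⟨by omega, by omega⟩)).1 (hj2 _ (by omega) (by omega))

/-! ### Equality constraints are invariant under renaming of the data values -/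

def DataWord.rename (π : ℕ → ℕ) (w : DataWord P) : DataWord P := fun i => ((w i).1, π (w i).2)

theorem TPTL.sat_rename {π : ℕ → ℕ} (hπ : Function.Injective π) (w : DataWord P) {φ : TPTL P}
    (hφ : φ.OnlyEq) (i : ℕ) (ν : ℕ → ℕ) :
    φ.Sat (w.rename π) i (π ∘ ν) ↔ φ.Sat w i ν := by
  induction φ generalizing i ν with
  | prop p => rfl
  | cmp x I =>
    obtain rfl : I = IntInterval.zero := hφ
    have := hπ.eq_iff (a := (w i).2) (b := ν x)
    have h0 : ∀ a b : ℕ, (a : ℤ) - b ∈ IntInterval.zero.toSet ↔ a = b := fun a b => by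
      refine (IntInterval.mem_point (c := 0)).trans ?_
      omega
    simp only [Sat, DataWord.val, DataWord.rename, Function.comp, h0, this]
  | neg φ ih => simp only [Sat, ih hφ]
  | and φ ψ ih1 ih2 => simp only [Sat, ih1 hφ.1, ih2 hφ.2]
  | untl φ ψ ih1 ih2 => simp only [Sat, ih1 hφ.1, ih2 hφ.2]
  | freeze x φ ih =>
    simp only [Sat, ← ih hφ, Function.comp_update]
    rfl

/-! ### Unary formulas on periodic words -/

/-- `X` shortens the window of agreement by one letter. For `F`, a witness not beyond `j` is moved
past `j` by whole periods, where the letters repeat. Each operator uses up at most one period of the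
room before `M`. -/
theorem TPTL.IsUnary.sat_periodic {c : ℕ → Set P} {l M d : ℕ} (hl : 0 < l)
    (hc : ∀ i, c (i + l) = c i) {w : DataWord P} (hw : ∀ i < M, w i = (c i, d)) {φ : TPTL P}
    (hφ : φ.IsUnary) {i j : ℕ} (ν : ℕ → ℕ) (hi : i + (φ.urk + 1) * l ≤ M)
    (hj : j + (φ.urk + 1) * l ≤ M) (hij : ∀ k ≤ φ.urk, c (i + k) = c (j + k))
    (h : φ.Sat w i ν) : φ.Sat w j ν := by
  have hM : ∀ {i r : ℕ}, i + (r + 1) * l ≤ M → i < M := by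
    intro i r h
    have : 0 < (r + 1) * l := by positivity
    omega
  induction hφ generalizing i j ν with
  | prop p =>
    have : c i = c j := hij 0 (Nat.zero_le _)
    simpa [Sat, hw _ (hM hi), hw _ (hM hj), this] using h
  | cmp x I => simpa [Sat, DataWord.val, hw _ (hM hi), hw _ (hM hj)] using h
  | neg _ ih => exact fun h' => h (ih ν hj hi (fun k hk => (hij k hk).symm) h')
  | @and φ ψ _ _ ih1 ih2 =>
    simp only [urk] at hi hj hij
    have h1 : (φ.urk + 1) * l ≤ (max φ.urk ψ.urk + 1) * l :=
      Nat.mul_le_mul_right _ (by omega)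
    have h2 : (ψ.urk + 1) * l ≤ (max φ.urk ψ.urk + 1) * l :=
      Nat.mul_le_mul_right _ (by omega)
    exact ⟨ih1 ν (by omega) (by omega) (fun k hk => hij k (by omega)) h.1,
      ih2 ν (by omega) (by omega) (fun k hk => hij k (by omega)) h.2⟩
  | @freeze x φ _ ih =>
    have := ih (Function.update ν x d) hi hj hij
    have hi' := hM hi
    have hj' := hM hj
    simp only [Sat, hw _ hi', hw _ hj'] at h ⊢
    exact this h
  | @next p φ _ ih =>
    rw [urk_next] at hi hj hij
    rw [sat_next] at h ⊢
    have : (φ.urk + 1 + 1) * l = (φ.urk + 1) * l + l := by ring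
    exact ih ν (by omega) (by omega)
      (fun k hk => by have := hij (1 + k) (by omega); simpa only [add_assoc] using this) h
  | @eventually p φ _ ih =>
    rw [urk_eventually] at hi hj hij
    rw [sat_eventually] at h ⊢
    obtain ⟨m, hm, h⟩ := h
    by_cases hmj : j < m
    · exact ⟨m, hmj, h⟩
    have hcm : ∀ q i, c (i + q * l) = c i := by
      intro q
      induction q with
      | zero => simp
      | succ q ih => intro i; rw [Nat.succ_mul, ← add_assoc, hc, ih]
    -- The least shift that moves `m` past `j`; it ends at most at `j + l`.
    set q := (j - m) / l + 1 with hq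
    have hdm := Nat.div_add_mod (j - m) l
    have hlt := Nat.mod_lt (j - m) hl
    have hql : q * l = l * ((j - m) / l) + l := by rw [hq]; ring
    have hr : (φ.urk + 1 + 1) * l = (φ.urk + 1) * l + l := by ring
    refine ⟨m + q * l, by omega, ih ν (by omega) (by omega) (fun k _ => ?_) h⟩
    rw [add_right_comm, hcm]

end DataLogic

namespace DataLogic

variable {P : Type*}

/-! ### Words that a fragment cannot tell apart -/

/-- `φ`-positive and `φ`-negative data words that `ψ` does not separate; the former ends with `t`. -/
def Confuses (ψ : TPTL P) (φ : MTL P) (t : DataWord P) : Prop :=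
  ∃ w w' : DataWord P, (∃ c, 0 < c ∧ w.suf c = t) ∧ φ.Sat w 0 ∧ ¬ φ.Sat w' 0 ∧
    (w ∈ ψ.lang → w' ∈ ψ.lang)

/-- `X^n φ`. -/
def MTL.nexts (p : P) (φ : MTL P) : ℕ → MTL P
  | 0 => φ
  | n + 1 => .next p .all (nexts p φ n)

theorem MTL.sat_nexts {p : P} {φ : MTL P} {n : ℕ} {w : DataWord P} {i : ℕ} :
    (nexts p φ n).Sat w i ↔ φ.Sat w (i + n) := by
  induction n generalizing i with
  | zero => rfl
  | succ n ih => simp [nexts, ih, add_assoc, add_comm 1 n]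

theorem MTL.urk_nexts {p : P} {φ : MTL P} {n : ℕ} : (nexts p φ n).urk = φ.urk + n := by
  induction n with
  | zero => rfl
  | succ n ih => simp [nexts, next, ff, urk, ih, add_assoc]

/-- The words start with `k + 1` and `k + 2` letters containing `p`, both too many for rank `k` to
distinguish. The position `k + 1` is the start of `t` only in the first, which is why halting words
are required to start without `p`. -/
theorem confuses_of_urk_le {p : P} {ψ : TPTL P} {k : ℕ} (hψ : ψ.urk ≤ k) {t : DataWord P}
    (ht : p ∉ (t 0).1) : Confuses ψ (.nexts p (.neg (.prop p)) (k + 1)) t := by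
  refine ⟨.rep ({p}, 0) (k + 1) t, .rep ({p}, 0) (k + 2) t,
    ⟨k + 1, by omega, DataWord.suf_rep_self ..⟩, ?_, ?_, fun h => ?_⟩
  · simpa [MTL.sat_nexts, DataWord.rep] using ht
  · simp [MTL.sat_nexts, DataWord.rep]
  · have := TPTL.sat_rep ({p}, 0) t ψ (fun _ => 0) (a := k + 1) (b := k + 2) (by omega) (by omega)
    exact this h

/-- A descent from `a + 1` to `a` in front of `t` becomes an ascent when the two values are swapped
throughout. -/
theorem confuses_of_onlyEq {p : P} {ψ : TPTL P} (hψ : ψ.OnlyEq) (t : DataWord P) :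
    Confuses ψ (.next p .neg (.tt p)) t := by
  set a := (t 0).2 with ha
  refine ⟨.cons (∅, a + 1) t, (DataWord.cons (∅, a + 1) t).rename (Equiv.swap a (a + 1)),
    ⟨1, one_pos, rfl⟩, ?_, ?_, fun h => ?_⟩
  · simp [DataWord.val, DataWord.cons, ← ha]
  · simp [DataWord.val, DataWord.cons, DataWord.rename, ← ha]
  · exact (TPTL.sat_rename (Equiv.injective _) _ hψ 0 _).2 h

theorem confuses_of_isUnary {p : P} {ψ : TPTL P} (hψ : ψ.IsUnary) (t : DataWord P) :
    Confuses ψ (.untl .all (.neg (.prop p)) (.and (.prop p) (.next p .all (.prop p)))) t := by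
  set k := ψ.urk with hk
  set l := 2 * k + 5 with hl
  set M := (k + 3) * l with hM
  have hM' : M = (k + 1) * l + l + l := by rw [hM]; ring
  -- Each period has a pair of adjacent `p` and then a single `p`. The windows `0, …, k` and `k + 3,
  -- …, 2 * k + 3` are free of `p`; after the first comes the pair, after the second the single `p`.
  let c : ℕ → Set P := fun i => {_q | i % l = k + 1 ∨ i % l = k + 2 ∨ i % l = 2 * k + 4}
  let w : DataWord P := fun i => if i < M then (c i, 0) else t (i - M)
  have hw : ∀ i < M, w i = (c i, 0) := fun i hi => if_pos hi
  have hwl : ∀ i ≤ l, p ∈ (w i).1 ↔ i = k + 1 ∨ i = k + 2 ∨ i = 2 * k + 4 := by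
    intro i hi
    rw [hw i (by omega)]
    change (i % l = k + 1 ∨ i % l = k + 2 ∨ i % l = 2 * k + 4) ↔ _
    rcases hi.eq_or_lt with rfl | hi
    · rw [Nat.mod_self]; omega
    · rw [Nat.mod_eq_of_lt hi]
  refine ⟨w, w.suf (k + 3), ⟨M, by omega, ?_⟩, ?_, ?_, fun h => ?_⟩
  · funext i
    simp [DataWord.suf, w]
  · refine ⟨k + 1, by omega, ⟨(hwl _ (by omega)).2 (by omega), MTL.sat_next.2
      ⟨(hwl _ (by omega)).2 (by omega), IntInterval.mem_all⟩⟩, IntInterval.mem_all,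
      fun i h1 h2 h => ?_⟩
    have := (hwl i (by omega)).1 h
    omega
  · rw [MTL.sat_suf]
    rintro ⟨j, hj, ⟨h1, h2⟩, -, h3⟩
    have h2 := (MTL.sat_next.1 h2).1
    by_cases hj4 : 2 * k + 4 < j
    · exact h3 (2 * k + 4) (by omega) hj4 ((hwl _ (by omega)).2 (by omega))
    · have e1 := (hwl j (by omega)).1 h1
      have e2 := (hwl (j + 1) (by omega)).1 h2
      omega
  · have h0 : (w 0).2 = 0 := by rw [hw 0 (by omega)]
    have h0' : (w.suf (k + 3) 0).2 = 0 := by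
      change (w (0 + (k + 3))).2 = 0
      rw [hw _ (by omega)]
    simp only [TPTL.lang, Set.mem_ofPred_eq, h0, h0'] at h ⊢
    rw [TPTL.sat_suf, Nat.zero_add]
    refine hψ.sat_periodic (l := l) (M := M) (d := 0) (c := c) (by omega) (fun i => ?_) hw _ ?_ ?_
      (fun d hd => ?_) h
    · simp [c]
    · rw [← hk]; omega
    · rw [← hk]; omega
    · have : ∀ i < l, i ≠ k + 1 → i ≠ k + 2 → i ≠ 2 * k + 4 → c i = ∅ := by
        intro i hi h1 h2 h3
        refine Set.eq_empty_of_forall_notMem fun q hq => ?_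
        change i % l = k + 1 ∨ i % l = k + 2 ∨ i % l = 2 * k + 4 at hq
        rw [Nat.mod_eq_of_lt hi] at hq
        omega
      rw [this (0 + d) (by omega) (by omega) (by omega) (by omega),
        this (k + 3 + d) (by omega) (by omega) (by omega) (by omega)]

/-! ### The reduction -/

theorem definableIn_toTPTL_iff {p : P} {S : Set (TPTL P)}
    (hff : TPTL.and (.prop p) (.neg (.prop p)) ∈ S) {φ χ : MTL P}
    (hχ : ∀ t, χ.Sat t 0 → p ∉ (t 0).1)
    (hS : ∀ ψ ∈ S, ∀ t : DataWord P, p ∉ (t 0).1 → Confuses ψ φ t) :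
    (MTL.and φ (.eventually p χ)).toTPTL.DefinableIn S ↔ ¬ ∃ t, χ.Sat t 0 := by
  have hmem : ∀ w, w ∈ (MTL.and φ (.eventually p χ)).lang ↔
      φ.Sat w 0 ∧ ∃ c, 0 < c ∧ χ.Sat (w.suf c) 0 := by
    intro w
    simp only [MTL.lang, Set.mem_ofPred_eq, MTL.sat_and, MTL.sat_eventually, MTL.sat_suf,
      Nat.zero_add]
  constructor
  · rintro ⟨ψ, hψ, h⟩ ⟨t, ht⟩
    rw [MTL.lang_toTPTL] at h
    obtain ⟨w, w', ⟨c, hc, rfl⟩, h1, h2, h3⟩ := hS ψ hψ t (hχ t ht)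
    rw [h] at h3
    exact h2 ((hmem w').1 (h3 ((hmem w).2 ⟨h1, c, hc, ht⟩))).1
  · intro h
    refine ⟨_, hff, ?_⟩
    rw [MTL.lang_toTPTL]
    ext w
    rw [hmem]
    constructor
    · exact fun hw => (hw.2 hw.1).elim
    · rintro ⟨-, c, -, hc⟩
      exact (h ⟨_, hc⟩).elim

/-- Not definable in TPTL of rank `k` implies not definable in MTL of rank `k`, by the
rank-preserving translation; only the empty language needs an MTL formula of its own. -/
theorem definableIn_iff_toTPTL {p : P} {k : ℕ} {φ χ : MTL P}
    (hχ : ∀ t, χ.Sat t 0 → p ∉ (t 0).1)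
    (hS : ∀ ψ ∈ TPTLRank P k, ∀ t : DataWord P, p ∉ (t 0).1 → Confuses ψ φ t) :
    (MTL.and φ (.eventually p χ)).DefinableIn (MTLRank P k) ↔ ¬ ∃ t, χ.Sat t 0 := by
  have hff : TPTL.and (.prop p) (.neg (.prop p)) ∈ TPTLRank P k := Nat.zero_le k
  constructor
  · rintro ⟨ψ, hψ, h⟩
    refine (definableIn_toTPTL_iff hff hχ hS).1 ⟨ψ.toTPTL, ?_, ?_⟩
    · exact ψ.urk_toTPTL.trans_le hψ
    · rw [MTL.lang_toTPTL, MTL.lang_toTPTL, h]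
  · intro h
    obtain ⟨-, -, hψ⟩ := (definableIn_toTPTL_iff hff hχ hS).2 h
    refine ⟨.ff p, Nat.zero_le k, Set.ext fun w => ?_⟩
    simp only [MTL.lang, Set.mem_ofPred_eq, MTL.sat_ff, MTL.sat_and, MTL.sat_eventually, false_iff,
      not_and]
    rintro - ⟨j, -, hj⟩
    exact h ⟨w.suf j, by rwa [MTL.sat_suf, Nat.zero_add]⟩

/-! ### Computability of the reduction -/

theorem exists_partrec_not_computablePred :
    ∃ f : ℕ →. ℕ, Partrec f ∧ ¬ ComputablePred fun n => (f n).Dom := by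
  refine ⟨fun n => (Denumerable.ofNat Nat.Partrec.Code n).eval 0,
    Nat.Partrec.Code.eval_part.comp (Computable.ofNat _) (Computable.const 0), fun h => ?_⟩
  refine ComputablePred.halting_problem 0 ?_
  refine ComputablePred.computable_of_manyOneReducible ⟨Encodable.encode, Computable.encode, ?_⟩ h
  intro c
  simp

theorem primrec_pair {f g : ℕ → ℕ} (hf : Primrec f) (hg : Primrec g) :
    Primrec fun n => Nat.pair (f n) (g n) :=
  Primrec₂.natPair.comp hf hg

theorem primrec_code_point : Primrec fun n : ℕ => (IntInterval.point n).code := by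
  have h : Primrec fun n : ℕ => intCode n := by
    simpa [intCode] using primrec_pair Primrec.id (Primrec.const 0)
  exact primrec_pair (primrec_pair (.const 1) h) (primrec_pair (.const 1) h)

/-- Only the code of `[n,n]` varies with `n`; the rest of the formula contributes constants. -/
theorem primrec_code_haltF [Encodable P] (N : Net) (e : N.Node → ℕ) (p : P) (φ : MTL P) :
    Primrec fun n => (MTL.and φ (.eventually p (haltF N e p n))).code := by
  simp only [haltF, MTL.eventually, MTL.next, MTL.code]
  exact primrec_pair (.const _) (primrec_pair (.const _) (primrec_pair (.const _)
    (primrec_pair (.const _) (primrec_pair (.const _) (primrec_pair (.const _)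
    (primrec_pair (primrec_pair (.const _) (primrec_pair primrec_code_point (.const _)))
      (.const _)))))))

theorem primrec_code_toTPTL_haltF [Encodable P] (N : Net) (e : N.Node → ℕ) (p : P) (φ : MTL P) :
    Primrec fun n => (MTL.and φ (.eventually p (haltF N e p n))).toTPTL.code := by
  simp only [haltF, MTL.eventually, MTL.next, MTL.toTPTL, TPTL.code]
  have h := primrec_pair (.const 5) <| primrec_pair (.const 0) <| primrec_pair (.const 4) <|
    primrec_pair (.const (MTL.ff p).toTPTL.code) <| primrec_pair (.const 3) <|
    primrec_pair (primrec_pair (.const 1) (primrec_pair (.const 0) primrec_code_point))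
    (.const (MTL.tt p).toTPTL.code)
  exact primrec_pair (.const _) <| primrec_pair (.const _) <| primrec_pair (.const _) <|
    primrec_pair (.const _) <| primrec_pair (.const _) <| primrec_pair (.const _) <|
    primrec_pair (.const _) <| primrec_pair (.const _) <| primrec_pair (.const _) <|
    primrec_pair h (.const _)

theorem not_decidableProblem {α : Type*} {code : α → ℕ} {inst : Set α} {Q : α → Prop} {q : ℕ → Prop}
    (hq : ¬ ComputablePred q) (F : ℕ → α) (hF : ∀ n, F n ∈ inst)
    (hcode : Primrec fun n => code (F n)) (hQ : ∀ n, Q (F n) ↔ ¬ q n) :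
    ¬ DecidableProblem code inst Q := by
  rintro ⟨A, hA, h⟩
  have h1 : ComputablePred fun n => A (code (F n)) :=
    ComputablePred.computable_of_manyOneReducible ⟨_, hcode.to_comp, fun _ => Iff.rfl⟩ hA
  exact hq (h1.not.of_eq fun n => by rw [h _ (hF n), hQ, not_not])

theorem exists_undecidable_family (p : P) :
    ∃ (N : Net) (e : N.Node → ℕ), ¬ ComputablePred fun n => ∃ w, (haltF N e p n).Sat w 0 := by
  obtain ⟨f, hf, hnf⟩ := exists_partrec_not_computablePred
  obtain ⟨N, hN⟩ := exists_net_dom hf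
  have := N.finite
  -- Any numbering of the nodes will do, as the automaton is fixed once and for all.
  obtain ⟨e, he⟩ := Countable.exists_injective_nat N.Node
  refine ⟨N, e, fun h => hnf (h.of_eq fun n => ?_)⟩
  simp only [exists_sat_haltF_iff he, hN, exists_const]

theorem urk_nexts_and_haltF_le {N : Net} {e : N.Node → ℕ} {p : P} {k : ℕ}
    (hk : (haltF N e p 0).urk ≤ k) (n : ℕ) :
    (MTL.and (.nexts p (.neg (.prop p)) (k + 1)) (.eventually p (haltF N e p n))).urk ≤ k + 1 := by
  have h : (haltF N e p n).urk = (haltF N e p 0).urk := rfl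
  simp only [MTL.urk, MTL.urk_nexts, MTL.eventually, MTL.tt, MTL.ff, h]
  omega

theorem not_mem_of_sat_haltF {N : Net} {e : N.Node → ℕ} {p : P} {n : ℕ} (t : DataWord P)
    (h : (haltF N e p n).Sat t 0) : p ∉ (t 0).1 :=
  h.2.1

end DataLogic

theorem mainTheorem12 {P : Type*} [Finite P] [Nonempty P] [Encodable P] :
    (∃ m : ℕ, ∀ k : ℕ, m ≤ k →
      ¬ DataLogic.DecidableProblem DataLogic.MTL.code (DataLogic.MTLRank P (k + 1))
        (fun φ => φ.DefinableIn (DataLogic.MTLRank P k))) ∧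
    (∃ m : ℕ, ∀ k : ℕ, m ≤ k →
      ¬ DataLogic.DecidableProblem DataLogic.TPTL.code (DataLogic.TPTLRank P (k + 1))
        (fun φ => φ.DefinableIn (DataLogic.TPTLRank P k))) ∧
    (¬ DataLogic.DecidableProblem DataLogic.TPTL.code (Set.univ : Set (DataLogic.TPTL P))
        (fun φ => φ.DefinableIn (DataLogic.TPTLeq P))) ∧
    (¬ DataLogic.DecidableProblem DataLogic.TPTL.code (Set.univ : Set (DataLogic.TPTL P))
        (fun φ => φ.DefinableIn (DataLogic.TPTLun P))) := by
  obtain ⟨p⟩ := ‹Nonempty P›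
  obtain ⟨N, e, hH⟩ := DataLogic.exists_undecidable_family p
  refine ⟨⟨(DataLogic.haltF N e p 0).urk, fun k hk => ?_⟩,
    ⟨(DataLogic.haltF N e p 0).urk, fun k hk => ?_⟩, ?_, ?_⟩
  · exact DataLogic.not_decidableProblem hH _ (DataLogic.urk_nexts_and_haltF_le hk)
      (DataLogic.primrec_code_haltF N e p _) fun n =>
      DataLogic.definableIn_iff_toTPTL DataLogic.not_mem_of_sat_haltF
        fun ψ hψ t ht => DataLogic.confuses_of_urk_le hψ ht
  · exact DataLogic.not_decidableProblem hH _
      (fun n => (DataLogic.MTL.urk_toTPTL _).trans_le (DataLogic.urk_nexts_and_haltF_le hk n))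
      (DataLogic.primrec_code_toTPTL_haltF N e p _) fun n =>
      DataLogic.definableIn_toTPTL_iff (Nat.zero_le k) DataLogic.not_mem_of_sat_haltF
        fun ψ hψ t ht => DataLogic.confuses_of_urk_le hψ ht
  · exact DataLogic.not_decidableProblem hH _ (fun n => Set.mem_univ _)
      (DataLogic.primrec_code_toTPTL_haltF N e p _) fun n =>
      DataLogic.definableIn_toTPTL_iff (S := DataLogic.TPTLeq P) (And.intro trivial trivial)
        DataLogic.not_mem_of_sat_haltF fun ψ hψ t _ => DataLogic.confuses_of_onlyEq (p := p) hψ t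
  · exact DataLogic.not_decidableProblem hH _ (fun n => Set.mem_univ _)
      (DataLogic.primrec_code_toTPTL_haltF N e p _) fun n =>
      DataLogic.definableIn_toTPTL_iff (S := DataLogic.TPTLun P)
        (DataLogic.TPTL.IsUnary.and (.prop p) (.neg (.prop p)))
        DataLogic.not_mem_of_sat_haltF fun ψ hψ t _ => DataLogic.confuses_of_isUnary (p := p) hψ t
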